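/- Let $N\ge 11$ be an integer and let $f\in C^1(\mathbb R)\cap C^2(\mathbb R\setminus\{0\})$ be odd, with $f(u)>0$, $f'(u)>0$, $f''(u)>0$ and $F(u):=\int_u^\infty \frac{ds}{f(s)}<\infty$ for all $u>0$. For each $\alpha>0$ let $u(\cdot,\alpha)$ be the unique solution of $$u''+\frac{N-1}{r}u'+f(u)=0\quad (r>0),\qquad u(0)=\alpha,\quad u'(0)=0$$ (it exists on all of $[0,\infty)$). Call $u(\cdot,\alpha)$ stable if $$\int_{\mathbb R^N}\bigl(|\nabla\phi(x)|^2-f'(u(|x|,\alpha))\,\phi(x)^2\bigr)\,dx\ge 0\qquad\text{for all }\phi\in C^1_0(\mathbb R^N),$$ where $C^1_0(\mathbb R^N)$ is the set of compactly supported $C^1$ functions, and unstable otherwise. Suppose that the finite limit $q_\infty=\lim_{u\to\infty}f'(u)F(u)$ exists and that $$q_\infty>q_{JL}:=\frac{N-2\sqrt{N-1}}{4}.$$ Then there exists $\hat\alpha>0$ such that $u(\cdot,\alpha)$ is unstable for every $\alpha>\hat\alpha$. Consequently, one of the following two structures holds: (I) $u(\cdot,\alpha)$ is unstable for every $\alpha>0$;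 (III) there exists $\alpha^*\in(0,\infty)$ such that $u(\cdot,\alpha)$ is stable for $\alpha\in(0,\alpha^*]$ and unstable for $\alpha>\alpha^*$, and, for each fixed $r>0$, $u(r,\alpha)$ is strictly increasing in $\alpha\in(0,\alpha^*)$. -/

import Mathlib

namespace RadialStability

open Set MeasureTheory Filter Topology

noncomputable section

/-- `F(u) = ∫_u^∞ ds / f(s)`. -/
def tailIntegral (f : ℝ → ℝ) (u : ℝ) : ℝ :=
  ∫ s in Ioi u, 1 / f s

/-- The standing assumptions on the nonlinearity `f`. The integrability field says `F(u) < ∞`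
(the integrand is positive). -/
structure IsNonlinearity (f : ℝ → ℝ) : Prop where
  contDiff_one : ContDiff ℝ 1 f
  contDiffOn_two : ContDiffOn ℝ 2 f {0}ᶜ
  odd : ∀ u, f (-u) = -f u
  pos : ∀ u, 0 < u → 0 < f u
  deriv_pos : ∀ u, 0 < u → 0 < deriv f u
  deriv_deriv_pos : ∀ u, 0 < u → 0 < deriv (deriv f) u
  tail_integrable : ∀ u, 0 < u → IntegrableOn (fun s => 1 / f s) (Ioi u)

/-- `w : [0, ∞) → ℝ` (values at negative arguments are irrelevant) solves
`w'' + (N - 1) / r * w' + f(w) = 0` for `r > 0`, `w(0) = α`, `w'(0) = 0`, the derivative at `0`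
being one-sided. For continuous `f` such a `w` is automatically `C²` on `(0, ∞)`. -/
structure IsRadialSolution (N : ℕ) (f : ℝ → ℝ) (α : ℝ) (w : ℝ → ℝ) : Prop where
  initial_value : w 0 = α
  initial_slope : HasDerivWithinAt w 0 (Ici 0) 0
  differentiable : ∀ r, 0 < r → DifferentiableAt ℝ w r
  deriv_differentiable : ∀ r, 0 < r → DifferentiableAt ℝ (deriv w) r
  equation : ∀ r, 0 < r →
    deriv (deriv w) r + ((N : ℝ) - 1) / r * deriv w r + f (w r) = 0

/-- Stability of `U : ℝ^N → ℝ`: `∫ (|∇φ|² - f'(U) φ²) dx ≥ 0` for all `φ ∈ C¹_0(ℝ^N)`. -/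
def IsStable (N : ℕ) (f : ℝ → ℝ) (U : EuclideanSpace ℝ (Fin N) → ℝ) : Prop :=
  ∀ φ : EuclideanSpace ℝ (Fin N) → ℝ, ContDiff ℝ 1 φ → HasCompactSupport φ →
    0 ≤ ∫ x, (‖gradient φ x‖ ^ 2 - deriv f (U x) * φ x ^ 2)

/-- Stability of the radial function `x ↦ w(|x|)` on `ℝ^N`. Unstable means not stable. -/
def IsRadiallyStable (N : ℕ) (f : ℝ → ℝ) (w : ℝ → ℝ) : Prop :=
  IsStable N f (fun x => w ‖x‖)

/-- The Joseph–Lundgren-type exponent `q_JL = (N - 2 √(N - 1)) / 4`. -/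
def qJL (N : ℕ) : ℝ :=
  ((N : ℝ) - 2 * Real.sqrt ((N : ℝ) - 1)) / 4

/-- Structure (I), for a family `u α = u(·, α)`: every `u(·, α)`, `α > 0`, is unstable. -/
def StructureI (N : ℕ) (f : ℝ → ℝ) (u : ℝ → ℝ → ℝ) : Prop :=
  ∀ α, 0 < α → ¬ IsRadiallyStable N f (u α)

/-- Structure (III): there is a threshold `α* ∈ (0, ∞)` such that `u(·, α)` is stable for
`α ∈ (0, α*]` and unstable for `α > α*`; moreover, for each fixed `r > 0`, `u(r, α)` is strictly
increasing in `α ∈ (0, α*)`. -/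
def StructureIII (N : ℕ) (f : ℝ → ℝ) (u : ℝ → ℝ → ℝ) : Prop :=
  ∃ αs : ℝ, 0 < αs ∧
    (∀ α, 0 < α → α ≤ αs → IsRadiallyStable N f (u α)) ∧
    (∀ α, αs < α → ¬ IsRadiallyStable N f (u α)) ∧
    (∀ r, 0 < r → StrictMonoOn (fun α => u α r) (Ioo 0 αs))

end

end RadialStability

namespace RadialStability

open Set MeasureTheory Filter Topology

/-! ### Elementary properties of the nonlinearity -/

namespace IsNonlinearity

variable {f : ℝ → ℝ}

/-! Instability for large α. Put n = N - 1, v = F(u) and ε = v(0) = F(α). Then (r^n v')' = r^n (1 +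
f'(u) v'²), and f'(u) v = f'(u) F(u) is close to q = q_∞ while u is large. Suppose u is stable and
let ρ be a radius with v(ρ) = A = Kε. Write B = ∫ r^n v^(-2m-1) and I = ∫ r^n v^(-2m-2) v'² over [0,
ρ]. Up to small tolerances, the test function v^(-m) - A^(-m) gives q B ≤ m² I + error, with error 2
q A^(-m) ∫ r^n v^(-m-1), while multiplying the equation by v^(-2m-1) gives (2m + 1 - q) I ≤ B. If m²
< q (2m + 1 - q), that is |m - q| < √q, then B is bounded by a multiple of the error.

Since v ≥ ε + r²/(2N), and v is comparable to ε for r up to a multiple of √ε, the powers of ε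
cancel: the error divided by B is at most a constant times K^(b-2m-1), for any b > N/2 with b ≥ m +
1. If m > (N-2)/4, some such b lies below 2m + 1 and a large K gives a contradiction. Both
conditions on m can be met because q + √q > (N-2)/4, which is exactly q > q_JL = (√(N-1) - 1)²/4.
The constants do not depend on α, and F(α) → 0 keeps u large until v = Kε once α is large. The
estimate is `StableProfile.growth_bound`, the choice of m is `exists_exponents`.

Structure. By convexity of f, a solution starting below a stable one stays positive and strictly
below it (`pos_and_lt_of_stable`): at a first contact the smaller solution, or the difference, would
be a test function contradicting stability. As f' increases on [0, ∞), stability passes to smaller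
α; by dominated convergence it passes to the supremum of the stable values. Existence is a
contraction argument in a weighted norm, uniqueness a Gronwall-type estimate with the same weight.
-/

theorem continuous (hf : IsNonlinearity f) : Continuous f := hf.contDiff_one.continuous

theorem differentiable (hf : IsNonlinearity f) : Differentiable ℝ f :=
  hf.contDiff_one.differentiable one_ne_zero

theorem hasDerivAt (hf : IsNonlinearity f) (x : ℝ) : HasDerivAt f (deriv f x) x :=
  (hf.differentiable x).hasDerivAt

theorem continuous_deriv (hf : IsNonlinearity f) : Continuous (deriv f) :=
  hf.contDiff_one.continuous_deriv le_rfl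

theorem map_zero (hf : IsNonlinearity f) : f 0 = 0 := by
  have h := hf.odd 0
  rw [neg_zero] at h
  linarith

theorem deriv_neg (hf : IsNonlinearity f) (x : ℝ) : deriv f (-x) = deriv f x := by
  have h : (fun y => f (-y)) = fun y => -f y := funext hf.odd
  have h1 := deriv_comp_neg f x
  rw [h, deriv.fun_neg] at h1
  linarith

theorem deriv_abs (hf : IsNonlinearity f) (x : ℝ) : deriv f |x| = deriv f x := by
  rcases abs_choice x with h | h <;> rw [h]
  exact hf.deriv_neg x

theorem strictMonoOn_deriv (hf : IsNonlinearity f) : StrictMonoOn (deriv f) (Ici 0) :=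
  strictMonoOn_of_deriv_pos (convex_Ici 0) hf.continuous_deriv.continuousOn fun x hx =>
    hf.deriv_deriv_pos x (by simpa using hx)

theorem strictMonoOn (hf : IsNonlinearity f) : StrictMonoOn f (Ici 0) :=
  strictMonoOn_of_deriv_pos (convex_Ici 0) hf.continuous.continuousOn fun x hx =>
    hf.deriv_pos x (by simpa using hx)

theorem sub_lt_deriv_mul (hf : IsNonlinearity f) {a b : ℝ} (ha : 0 ≤ a) (hab : a < b) :
    f b - f a < deriv f b * (b - a) := by
  obtain ⟨c, hc, h⟩ := exists_hasDerivAt_eq_slope f (deriv f) hab hf.continuous.continuousOn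
    fun x _ => hf.hasDerivAt x
  have h1 : f b - f a = deriv f c * (b - a) := by
    rw [h, div_mul_cancel₀ _ (sub_pos.2 hab).ne']
  rw [h1]
  exact mul_lt_mul_of_pos_right
    (hf.strictMonoOn_deriv (ha.trans hc.1.le) (ha.trans hab.le) hc.2) (sub_pos.2 hab)

theorem exists_lipschitz (hf : IsNonlinearity f) (B : ℝ) :
    ∃ L : ℝ, 0 < L ∧ ∀ x ∈ Icc (-B) B, ∀ y ∈ Icc (-B) B, |f x - f y| ≤ L * |x - y| := by
  obtain ⟨C, hC⟩ := (isCompact_Icc (a := -B) (b := B)).exists_bound_of_continuousOn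
    hf.continuous_deriv.continuousOn
  refine ⟨|C| + 1, by positivity, fun x hx y hy => ?_⟩
  have h := (convex_Icc (-B) B).norm_image_sub_le_of_norm_deriv_le (f := f) (C := |C| + 1)
    (fun z _ => hf.differentiable z) (fun z hz => (hC z hz).trans (by linarith [le_abs_self C]))
    hy hx
  simpa [Real.norm_eq_abs] using h

theorem tail_eq (hf : IsNonlinearity f) {a u : ℝ} (ha : 0 < a) (hu : 0 < u) :
    tailIntegral f u = tailIntegral f a - ∫ s in a..u, 1 / f s := by
  unfold tailIntegral
  rw [← intervalIntegral.integral_Ioi_sub_Ioi' (hf.tail_integrable a ha) (hf.tail_integrable u hu)]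
  ring

theorem hasDerivAt_tail (hf : IsNonlinearity f) {u : ℝ} (hu : 0 < u) :
    HasDerivAt (tailIntegral f) (-(1 / f u)) u := by
  have hc : ∀ x, 0 < x → ContinuousAt (fun s => 1 / f s) x := fun x hx =>
    continuousAt_const.div hf.continuous.continuousAt (hf.pos x hx).ne'
  have h1 : HasDerivAt (fun y => ∫ s in u..y, 1 / f s) (1 / f u) u := by
    refine intervalIntegral.integral_hasDerivAt_right (by simp) ?_ (hc u hu)
    exact ContinuousAt.stronglyMeasurableAtFilter isOpen_Ioi (fun x hx => hc x hx) u hu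
  refine (h1.const_sub (tailIntegral f u)).congr_of_eventuallyEq ?_
  filter_upwards [lt_mem_nhds hu] with y hy
  exact hf.tail_eq hu hy

theorem tail_pos (hf : IsNonlinearity f) {u : ℝ} (hu : 0 < u) : 0 < tailIntegral f u := by
  have hpos : ∀ x ∈ Ioi u, 0 < 1 / f x := fun x hx => one_div_pos.2 (hf.pos x (hu.trans hx))
  unfold tailIntegral
  rw [setIntegral_pos_iff_support_of_nonneg_ae ?_ (hf.tail_integrable u hu)]
  · have : Ioi u ⊆ Function.support (fun s => 1 / f s) ∩ Ioi u := fun x hx =>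
      ⟨(hpos x hx).ne', hx⟩
    refine lt_of_lt_of_le ?_ (measure_mono this)
    simp
  · filter_upwards [ae_restrict_mem measurableSet_Ioi] with x hx
    exact (hpos x hx).le

theorem tendsto_tail (hf : IsNonlinearity f) : Tendsto (tailIntegral f) atTop (𝓝 0) := by
  have h := intervalIntegral_tendsto_integral_Ioi 1 (hf.tail_integrable 1 one_pos) tendsto_id
  have h2 := h.const_sub (tailIntegral f 1)
  rw [show tailIntegral f 1 - (∫ s in Ioi 1, 1 / f s) = 0 from sub_self _] at h2
  refine h2.congr' ?_
  filter_upwards [eventually_gt_atTop 0] with u hu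
  exact (hf.tail_eq one_pos hu).symm

theorem tail_strictAnti (hf : IsNonlinearity f) : StrictAntiOn (tailIntegral f) (Ioi 0) := by
  refine strictAntiOn_of_deriv_neg (convex_Ioi 0)
    (fun x hx => (hf.hasDerivAt_tail hx).continuousAt.continuousWithinAt) fun x hx => ?_
  rw [interior_Ioi] at hx
  rw [(hf.hasDerivAt_tail hx).deriv]
  exact neg_neg_of_pos (one_div_pos.2 (hf.pos x hx))

end IsNonlinearity

/-! ### Existence for bounded Lipschitz nonlinearities -/

open scoped BoundedContinuousFunction

section Existence

variable {g : ℝ → ℝ} {M L : ℝ}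

theorem abs_weightedAverage_le (n : ℕ) (h : ℝ → ℝ) {C : ℝ} (hh : ∀ σ ∈ Ioc (0 : ℝ) 1, |h σ| ≤ C) :
    |∫ σ in (0 : ℝ)..1, σ ^ n * h σ| ≤ C := by
  have := intervalIntegral.norm_integral_le_of_norm_le_const (a := (0 : ℝ)) (b := 1) (C := C)
    (f := fun σ => σ ^ n * h σ) fun σ hσ => by
      rw [uIoc_of_le zero_le_one] at hσ
      rw [Real.norm_eq_abs, abs_mul, abs_of_nonneg (pow_nonneg hσ.1.le n)]
      calc σ ^ n * |h σ| ≤ 1 * |h σ| := by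
            gcongr
            exact pow_le_one₀ hσ.1.le hσ.2
        _ ≤ C := by simpa using hh σ hσ
  simpa using this

/-- The weight exp(L s²) is reproduced by the integral operator with a gain of 1/2, which is the
contraction constant below. -/
theorem integral_mul_exp_sq (r : ℝ) :
    ∫ s in (0 : ℝ)..r, L * s * Real.exp (L * s ^ 2) = (Real.exp (L * r ^ 2) - 1) / 2 := by
  have h : ∀ s ∈ uIcc 0 r, HasDerivAt (fun s => Real.exp (L * s ^ 2) / 2)
      (L * s * Real.exp (L * s ^ 2)) s := fun s _ => by
    refine ((((hasDerivAt_pow 2 s).const_mul L).exp).div_const 2).congr_deriv ?_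
    simp only [Nat.cast_ofNat, Nat.add_one_sub_one, pow_one]
    ring
  rw [intervalIntegral.integral_eq_sub_of_hasDerivAt h
    (Continuous.intervalIntegrable (by fun_prop) _ _)]
  simp
  ring

/-- The substitution t = sσ turns s^(-n) ∫₀^s t^n g(u) dt into s ∫₀¹ σ^n g(u(sσ)) dσ, which removes
the singularity at 0. Solutions may grow like r², so the fixed point is sought for z = exp(-L r²) u,
which is bounded; using |r| makes u even. -/
theorem exists_integral_equation (n : ℕ) (α : ℝ) (hL : 0 < L) (hM : ∀ x, |g x| ≤ M)
    (hg : ∀ x y, |g x - g y| ≤ L * |x - y|) :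
    ∃ u : ℝ → ℝ, Continuous u ∧
      ∀ r, u r = α - ∫ s in (0 : ℝ)..|r|, s * ∫ σ in (0 : ℝ)..1, σ ^ n * g (u (s * σ)) := by
  have hgc : Continuous g :=
    (LipschitzWith.of_dist_le_mul (K := ⟨L, hL.le⟩) fun x y => hg x y).continuous
  let avg : (ℝ →ᵇ ℝ) → ℝ → ℝ := fun z s =>
    ∫ σ in (0 : ℝ)..1, σ ^ n * g (Real.exp (L * (s * σ) ^ 2) * z (s * σ))
  have havg : ∀ z, Continuous (avg z) := fun z => by
    refine intervalIntegral.continuous_parametric_intervalIntegral_of_continuous' ?_ 0 1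
    have := z.continuous
    unfold Function.uncurry
    fun_prop
  let T : (ℝ →ᵇ ℝ) → ℝ → ℝ := fun z r =>
    Real.exp (-(L * r ^ 2)) * (α - ∫ s in (0 : ℝ)..|r|, s * avg z s)
  have hprim : ∀ z, Continuous fun r : ℝ => ∫ s in (0 : ℝ)..|r|, s * avg z s := fun z => by
    have h1 := havg z
    have h2 : Continuous fun r : ℝ => ∫ s in (0 : ℝ)..r, s * avg z s :=
      intervalIntegral.continuous_primitive
        (fun a b => (continuous_id.mul h1).intervalIntegrable a b) 0
    exact h2.comp continuous_abs
  have hTc : ∀ z, Continuous (T z) := fun z => by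
    have := hprim z
    exact (by fun_prop : Continuous fun r : ℝ => Real.exp (-(L * r ^ 2))).mul
      (continuous_const.sub this)
  have hM0 : 0 ≤ M := (abs_nonneg _).trans (hM 0)
  have hexp : ∀ r : ℝ, Real.exp (-(L * r ^ 2)) * Real.exp (L * r ^ 2) = 1 := fun r => by
    rw [← Real.exp_add]; simp
  have hTb : ∀ z r, ‖T z r‖ ≤ |α| + M / L := fun z r => by
    have h1 : |∫ s in (0 : ℝ)..|r|, s * avg z s| ≤ M * r ^ 2 := by
      have := intervalIntegral.norm_integral_le_of_norm_le_const (a := (0 : ℝ)) (b := |r|)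
        (C := |r| * M) (f := fun s => s * avg z s) fun s hs => by
          rw [uIoc_of_le (abs_nonneg r)] at hs
          rw [Real.norm_eq_abs, abs_mul, abs_of_nonneg hs.1.le]
          exact mul_le_mul hs.2 (abs_weightedAverage_le n _ fun σ _ => hM _) (abs_nonneg _)
            (abs_nonneg _)
      rw [sub_zero, abs_abs, Real.norm_eq_abs] at this
      calc _ ≤ _ := this
        _ = M * |r| ^ 2 := by ring
        _ = _ := by rw [sq_abs]
    have he1 : Real.exp (-(L * r ^ 2)) ≤ 1 := Real.exp_le_one_iff.2 (by
      have := sq_nonneg r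
      nlinarith)
    have he2 : Real.exp (-(L * r ^ 2)) * (L * r ^ 2) ≤ 1 := by
      rw [← hexp r]
      gcongr
      linarith [Real.add_one_le_exp (L * r ^ 2)]
    have he0 := Real.exp_pos (-(L * r ^ 2))
    calc ‖T z r‖ = Real.exp (-(L * r ^ 2)) * |α - ∫ s in (0 : ℝ)..|r|, s * avg z s| := by
          rw [Real.norm_eq_abs, abs_mul, abs_of_pos he0]
      _ ≤ Real.exp (-(L * r ^ 2)) * (|α| + M * r ^ 2) := by
          gcongr
          exact (abs_sub _ _).trans (by gcongr)
      _ = Real.exp (-(L * r ^ 2)) * |α| + M / L * (Real.exp (-(L * r ^ 2)) * (L * r ^ 2)) := by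
          field_simp
      _ ≤ 1 * |α| + M / L * 1 := by gcongr
      _ = _ := by ring
  let Φ : (ℝ →ᵇ ℝ) → (ℝ →ᵇ ℝ) := fun z =>
    BoundedContinuousFunction.ofNormedAddCommGroup (T z) (hTc z) _ (hTb z)
  have hcontr : ContractingWith (1 / 2) Φ := by
    refine ⟨by
      rw [← NNReal.coe_lt_coe]
      norm_num, LipschitzWith.of_dist_le_mul fun z w => ?_⟩
    rw [BoundedContinuousFunction.dist_le (by positivity)]
    intro r
    set D := dist z w
    have hD : 0 ≤ D := dist_nonneg
    have h1 : ∀ s ∈ Ioc 0 |r|, |avg z s - avg w s| ≤ D * (L * Real.exp (L * s ^ 2)) := by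
      intro s hs
      have hint : ∀ z : ℝ →ᵇ ℝ, IntervalIntegrable
          (fun σ => σ ^ n * g (Real.exp (L * (s * σ) ^ 2) * z (s * σ))) volume 0 1 := fun z => by
        have := z.continuous
        exact Continuous.intervalIntegrable (by fun_prop) _ _
      change |(∫ σ in (0 : ℝ)..1, σ ^ n * g (Real.exp (L * (s * σ) ^ 2) * z (s * σ))) -
        ∫ σ in (0 : ℝ)..1, σ ^ n * g (Real.exp (L * (s * σ) ^ 2) * w (s * σ))| ≤ _
      rw [← intervalIntegral.integral_sub (hint z) (hint w)]
      simp_rw [← mul_sub]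
      refine abs_weightedAverage_le n _ fun σ hσ => (hg _ _).trans ?_
      rw [← mul_sub, abs_mul, abs_of_pos (Real.exp_pos _)]
      have hdist : |z (s * σ) - w (s * σ)| ≤ D :=
        BoundedContinuousFunction.dist_coe_le_dist (f := z) (g := w) (s * σ)
      have hsσ : s * σ ≤ s := mul_le_of_le_one_right hs.1.le hσ.2
      have h0 : 0 ≤ s * σ := mul_nonneg hs.1.le hσ.1.le
      calc L * (Real.exp (L * (s * σ) ^ 2) * |z (s * σ) - w (s * σ)|)
          ≤ L * (Real.exp (L * s ^ 2) * D) := by gcongr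
        _ = _ := by ring
    have h2 : |(∫ s in (0 : ℝ)..|r|, s * avg w s) - ∫ s in (0 : ℝ)..|r|, s * avg z s| ≤
        D * ((Real.exp (L * r ^ 2) - 1) / 2) := by
      have hint : ∀ z : ℝ →ᵇ ℝ, IntervalIntegrable (fun s => s * avg z s) volume 0 |r| :=
        fun z => (continuous_id.mul (havg z)).intervalIntegrable _ _
      rw [← intervalIntegral.integral_sub (hint w) (hint z), ← sq_abs r,
        ← integral_mul_exp_sq, ← intervalIntegral.integral_const_mul, ← Real.norm_eq_abs]
      refine intervalIntegral.norm_integral_le_of_norm_le (abs_nonneg r)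
        (Eventually.of_forall fun s hs => ?_)
        (Continuous.intervalIntegrable (by fun_prop) _ _)
      rw [← mul_sub, Real.norm_eq_abs, abs_mul, abs_of_pos hs.1, abs_sub_comm]
      calc s * |avg z s - avg w s| ≤ s * (D * (L * Real.exp (L * s ^ 2))) := by
            gcongr
            · exact hs.1.le
            · exact h1 s hs
        _ = _ := by ring
    change |T z r - T w r| ≤ _
    have h3 : T z r - T w r = Real.exp (-(L * r ^ 2)) *
        ((∫ s in (0 : ℝ)..|r|, s * avg w s) - ∫ s in (0 : ℝ)..|r|, s * avg z s) := by
      change _ * _ - _ * _ = _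
      ring
    rw [h3, abs_mul, abs_of_pos (Real.exp_pos _)]
    calc _ ≤ Real.exp (-(L * r ^ 2)) * (D * ((Real.exp (L * r ^ 2) - 1) / 2)) := by gcongr
      _ = D / 2 * (Real.exp (-(L * r ^ 2)) * Real.exp (L * r ^ 2)) -
          D / 2 * Real.exp (-(L * r ^ 2)) := by ring
      _ ≤ D / 2 := by
        rw [hexp]
        have := mul_nonneg (half_pos one_pos).le (mul_nonneg hD (Real.exp_pos (-(L * r ^ 2))).le)
        linarith
      _ = _ := by
        push_cast
        ring
  set z := hcontr.fixedPoint Φ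
  have hz : Φ z = z := hcontr.fixedPoint_isFixedPt
  refine ⟨fun r => Real.exp (L * r ^ 2) * z r, ?_, fun r => ?_⟩
  · have := z.continuous
    fun_prop
  · have h1 : z r = T z r := by
      conv_lhs => rw [← hz]
      rfl
    calc Real.exp (L * r ^ 2) * z r = (Real.exp (-(L * r ^ 2)) * Real.exp (L * r ^ 2)) *
          (α - ∫ s in (0 : ℝ)..|r|, s * avg z s) := by
          rw [h1]
          change _ * (_ * _) = _
          ring
      _ = _ := by rw [hexp, one_mul]

end Existence

/-! ### Regular solutions -/

/-- `u` is an even `C¹` function on `ℝ` with derivative `du`, with `u 0 = α`, which solves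
`(r ^ n * u')' = - r ^ n * f u` in integrated form. -/
structure RegularSolution (n : ℕ) (f : ℝ → ℝ) (α : ℝ) (u du : ℝ → ℝ) : Prop where
  initial : u 0 = α
  even : ∀ r, u (-r) = u r
  hasDerivAt : ∀ r, HasDerivAt u (du r) r
  continuous_deriv : Continuous du
  deriv_zero : du 0 = 0
  flux : ∀ r, r ^ n * du r = -∫ t in (0 : ℝ)..r, t ^ n * f (u t)

namespace RegularSolution

variable {n : ℕ} {f u du : ℝ → ℝ} {α : ℝ}

theorem continuous (h : RegularSolution n f α u du) : Continuous u :=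
  continuous_iff_continuousAt.2 fun r => (h.hasDerivAt r).continuousAt

theorem deriv_eq (h : RegularSolution n f α u du) : deriv u = du :=
  funext fun r => (h.hasDerivAt r).deriv

theorem apply_abs (h : RegularSolution n f α u du) (r : ℝ) : u |r| = u r := by
  rcases abs_choice r with hr | hr <;> rw [hr]
  exact h.even r

theorem hasDerivAt_flux (h : RegularSolution n f α u du) (hf : Continuous f) (r : ℝ) :
    HasDerivAt (fun s => s ^ n * du s) (-(r ^ n * f (u r))) r := by
  have hu := h.continuous
  rw [show (fun s => s ^ n * du s) = _ from funext h.flux]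
  have hc : Continuous fun t => t ^ n * f (u t) := by fun_prop
  exact (hc.integral_hasStrictDerivAt 0 r).hasDerivAt.neg

theorem hasDerivAt_deriv (h : RegularSolution n f α u du) (hf : Continuous f) {r : ℝ}
    (hr : 0 < r) : HasDerivAt du (-(n / r * du r) - f (u r)) r := by
  have h1 := (h.hasDerivAt_flux hf r).div (hasDerivAt_pow n r) (pow_pos hr n).ne'
  have h2 : HasDerivAt du ((-(r ^ n * f (u r)) * r ^ n - r ^ n * du r * (n * r ^ (n - 1))) /
      (r ^ n) ^ 2) r := by
    refine h1.congr_of_eventuallyEq ?_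
    filter_upwards [lt_mem_nhds hr] with s hs
    have := (pow_pos hs n).ne'
    simp only [Pi.div_apply]
    field_simp
  refine h2.congr_deriv ?_
  have h3 : (n : ℝ) * r ^ (n - 1) = n * r ^ n / r := by
    rcases n with _ | k
    · simp
    · rw [Nat.add_sub_cancel, pow_succ]
      field_simp
  rw [h3]
  have := (pow_pos hr n).ne'
  field_simp
  ring

theorem isRadialSolution (h : RegularSolution n f α u du) (hf : Continuous f) :
    IsRadialSolution (n + 1) f α u where
  initial_value := h.initial
  initial_slope := by
    have := (h.hasDerivAt 0).hasDerivWithinAt (s := Ici 0)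
    rwa [h.deriv_zero] at this
  differentiable r _ := (h.hasDerivAt r).differentiableAt
  deriv_differentiable r hr := by
    rw [h.deriv_eq]
    exact (h.hasDerivAt_deriv hf hr).differentiableAt
  equation r hr := by
    rw [h.deriv_eq, (h.hasDerivAt_deriv hf hr).deriv]
    push_cast
    ring

/-- The energy u'²/2 + G(u), with G the primitive of f, does not increase in r, and G is even and
strictly increasing on [0, ∞). -/
theorem abs_le (h : RegularSolution n f α u du) (hα : 0 < α) (hf : Continuous f)
    (hodd : ∀ x, f (-x) = -f x) (hpos : ∀ x, 0 < x → 0 < f x) (r : ℝ) : |u r| ≤ α := by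
  set G : ℝ → ℝ := fun x => ∫ t in (0 : ℝ)..x, f t
  have hG : ∀ x, HasDerivAt G (f x) x := fun x =>
    (hf.integral_hasStrictDerivAt 0 x).hasDerivAt
  have hGc : Continuous G := continuous_iff_continuousAt.2 fun x => (hG x).continuousAt
  have hGeven : ∀ x, G (-x) = G x := fun x => by
    have h1 := intervalIntegral.integral_comp_neg (a := (0 : ℝ)) (b := x) f
    simp only [hodd, intervalIntegral.integral_neg, neg_zero] at h1
    change ∫ t in (0 : ℝ)..(-x), f t = ∫ t in (0 : ℝ)..x, f t
    rw [intervalIntegral.integral_symm]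
    linarith
  have hGabs : ∀ x, G |x| = G x := fun x => by
    rcases abs_choice x with hx | hx <;> rw [hx]
    exact hGeven x
  have hGmono : StrictMonoOn G (Ici 0) :=
    strictMonoOn_of_deriv_pos (convex_Ici 0) hGc.continuousOn fun x hx => by
      rw [(hG x).deriv]
      exact hpos x (by simpa using hx)
  have hE : AntitoneOn (fun s => du s ^ 2 / 2 + G (u s)) (Ici 0) := by
    have hd : ∀ s, 0 < s → HasDerivAt (fun s => du s ^ 2 / 2 + G (u s))
        (-(n / s * du s ^ 2)) s := fun s hs => by
      refine ((((h.hasDerivAt_deriv hf hs).pow 2).div_const 2).add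
        ((hG (u s)).comp s (h.hasDerivAt s))).congr_deriv ?_
      simp only [Nat.cast_ofNat, Nat.add_one_sub_one, pow_one]
      ring
    refine antitoneOn_of_deriv_nonpos (convex_Ici 0) ?_ ?_ ?_
    · have := h.continuous
      have := h.continuous_deriv
      exact Continuous.continuousOn (by fun_prop)
    · intro s hs
      rw [interior_Ici] at hs
      exact (hd s hs).differentiableAt.differentiableWithinAt
    · intro s hs
      rw [interior_Ici] at hs
      rw [(hd s hs).deriv]
      have : 0 < s := hs
      have : 0 ≤ n / s * du s ^ 2 := by positivity
      linarith
  have h1 := hE (mem_Ici.2 le_rfl) (mem_Ici.2 (abs_nonneg r)) (abs_nonneg r)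
  simp only [h.deriv_zero, h.initial, h.apply_abs] at h1
  have h2 : G |u r| ≤ G α := by
    rw [hGabs]
    have := sq_nonneg (du |r|)
    linarith
  exact (hGmono.le_iff_le (mem_Ici.2 (abs_nonneg _)) (mem_Ici.2 hα.le)).1 h2

end RegularSolution

theorem exists_regularSolution_of_lipschitz (n : ℕ) (α : ℝ) {g : ℝ → ℝ} {M L : ℝ} (hL : 0 < L)
    (hM : ∀ x, |g x| ≤ M) (hg : ∀ x y, |g x - g y| ≤ L * |x - y|) :
    ∃ u du : ℝ → ℝ, RegularSolution n g α u du := by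
  have hgc : Continuous g :=
    (LipschitzWith.of_dist_le_mul (K := ⟨L, hL.le⟩) fun x y => hg x y).continuous
  obtain ⟨u, huc, hu⟩ := exists_integral_equation n α hL hM hg
  set avg : ℝ → ℝ := fun s => ∫ σ in (0 : ℝ)..1, σ ^ n * g (u (s * σ))
  have havg : Continuous avg := by
    refine intervalIntegral.continuous_parametric_intervalIntegral_of_continuous' ?_ 0 1
    unfold Function.uncurry
    fun_prop
  have hueven : ∀ r, u (-r) = u r := fun r => by rw [hu, hu r, abs_neg]
  have havg_even : ∀ s, avg (-s) = avg s := fun s => by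
    simp only [avg, neg_mul, hueven]
  have hu' : ∀ r, u r = α - ∫ s in (0 : ℝ)..r, s * avg s := fun r => by
    rw [hu r]
    congr 1
    rcases abs_choice r with hr | hr <;> rw [hr]
    have h1 := intervalIntegral.integral_comp_neg (a := (0 : ℝ)) (b := r) fun s => s * avg s
    simp only [havg_even, neg_mul, intervalIntegral.integral_neg, neg_zero] at h1
    rw [intervalIntegral.integral_symm]
    change -(∫ s in (-r)..0, s * avg s) = _
    linarith
  have hc : Continuous fun s => s * avg s := continuous_id.mul havg
  refine ⟨u, fun r => -(r * avg r), ?_, hueven, fun r => ?_, hc.neg, by simp, fun r => ?_⟩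
  · rw [hu' 0]; simp
  · rw [show u = _ from funext hu']
    exact (hc.integral_hasStrictDerivAt 0 r).hasDerivAt.const_sub α
  · have h1 := intervalIntegral.smul_integral_comp_mul_left (a := (0 : ℝ)) (b := 1)
      (fun t => t ^ n * g (u t)) r
    rw [mul_zero, mul_one] at h1
    rw [← h1]
    simp only [mul_pow, mul_assoc, intervalIntegral.integral_const_mul, smul_eq_mul, avg]
    ring

theorem IsNonlinearity.exists_regularSolution {f : ℝ → ℝ} (hf : IsNonlinearity f) (n : ℕ) {α : ℝ}
    (hα : 0 < α) :
    ∃ u du : ℝ → ℝ, RegularSolution n f α u du ∧ ∀ r, |u r| ≤ α := by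
  -- Clamping to [-α, α] makes the nonlinearity bounded and Lipschitz. It stays odd and positive on
  -- (0, ∞), so the energy bound applies and shows that the clamp is never active along the
  -- solution.
  set c : ℝ → ℝ := fun x => max (-α) (min α x)
  have hc_mem : ∀ x, c x ∈ Icc (-α) α := fun x =>
    ⟨le_max_left _ _, max_le (by linarith) (min_le_left _ _)⟩
  have hc_id : ∀ x, |x| ≤ α → c x = x := fun x hx => by
    rw [_root_.abs_le] at hx
    simp only [c, min_eq_right hx.2, max_eq_right hx.1]
  have hc_odd : ∀ x, c (-x) = -c x := fun x => by
    simp only [c, min_def, max_def]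
    split_ifs <;> linarith
  have hc_lip : ∀ x y, |c x - c y| ≤ |x - y| := fun x y =>
    (abs_max_sub_max_le_max _ _ _ _).trans (max_le (by simp)
      ((abs_min_sub_min_le_max _ _ _ _).trans (max_le (by simp) le_rfl)))
  obtain ⟨L, hL, hlip⟩ := hf.exists_lipschitz α
  have hg : ∀ x y, |f (c x) - f (c y)| ≤ L * |x - y| := fun x y =>
    (hlip _ (hc_mem x) _ (hc_mem y)).trans (mul_le_mul_of_nonneg_left (hc_lip x y) hL.le)
  obtain ⟨M, hM⟩ := (isCompact_Icc (a := -α) (b := α)).exists_bound_of_continuousOn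
    hf.continuous.continuousOn
  obtain ⟨u, du, h⟩ := exists_regularSolution_of_lipschitz n α (g := fun x => f (c x)) hL
    (fun x => hM _ (hc_mem x)) hg
  have hcont : Continuous c := by fun_prop
  have hb := h.abs_le hα (hf.continuous.comp hcont) (fun x => by
      rw [← hf.odd]
      congr 1
      exact hc_odd x)
    (fun x hx => hf.pos _ (lt_max_of_lt_right (lt_min hα hx)))
  refine ⟨u, du, { h with flux := fun r => ?_ }, hb⟩
  rw [h.flux r]
  simp only [hc_id _ (hb _)]

/-! ### Uniqueness and continuous dependence -/

/-- One-sided version of `RegularSolution`, which only constrains `u` on `[0, ∞)`. -/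
structure IntegralSolution (n : ℕ) (f u du : ℝ → ℝ) : Prop where
  hasDerivWithinAt : ∀ r, 0 ≤ r → HasDerivWithinAt u (du r) (Ici r) r
  continuousOn : ContinuousOn u (Ici 0)
  deriv_zero : du 0 = 0
  flux : ∀ r, 0 < r → r ^ n * du r = -∫ t in (0 : ℝ)..r, t ^ n * f (u t)

theorem RegularSolution.integralSolution {n : ℕ} {f u du : ℝ → ℝ} {α : ℝ}
    (h : RegularSolution n f α u du) : IntegralSolution n f u du :=
  ⟨fun r _ => (h.hasDerivAt r).hasDerivWithinAt, h.continuous.continuousOn, h.deriv_zero,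
    fun r _ => h.flux r⟩

/-- With S the maximum over [0, R] of |u - w| exp(-L r²), the flux identity bounds |u' - w'| by S L
t exp(L t²). Integrating up to the maximum point gives S ≤ |u(0) - w(0)| + S/2, hence the factor 2.
-/
theorem IntegralSolution.abs_sub_le {n : ℕ} {f u du w dw : ℝ → ℝ}
    (hu : IntegralSolution n f u du) (hw : IntegralSolution n f w dw) (hf : Continuous f)
    {B L R : ℝ} (hL : 0 < L)
    (hlip : ∀ x ∈ Icc (-B) B, ∀ y ∈ Icc (-B) B, |f x - f y| ≤ L * |x - y|)
    (huB : ∀ r ∈ Icc 0 R, |u r| ≤ B) (hwB : ∀ r ∈ Icc 0 R, |w r| ≤ B) {r : ℝ}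
    (hr : r ∈ Icc 0 R) :
    |u r - w r| ≤ 2 * |u 0 - w 0| * Real.exp (L * r ^ 2) := by
  have hsub : Icc 0 R ⊆ Ici (0 : ℝ) := Icc_subset_Ici_self
  have hd : ContinuousOn (fun r => u r - w r) (Icc 0 R) :=
    (hu.continuousOn.mono hsub).sub (hw.continuousOn.mono hsub)
  obtain ⟨r₀, hr₀, hmax⟩ := isCompact_Icc.exists_isMaxOn (nonempty_of_mem hr)
    (hd.abs.mul (by fun_prop : Continuous fun r : ℝ => Real.exp (-(L * r ^ 2))).continuousOn)
  set S := |u r₀ - w r₀| * Real.exp (-(L * r₀ ^ 2))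
  have hS : 0 ≤ S := by positivity
  have hexp : ∀ r : ℝ, Real.exp (-(L * r ^ 2)) * Real.exp (L * r ^ 2) = 1 := fun r => by
    rw [← Real.exp_add]; simp
  have hle : ∀ t ∈ Icc 0 R, |u t - w t| ≤ S * Real.exp (L * t ^ 2) := fun t ht => by
    have h1 : |u t - w t| * Real.exp (-(L * t ^ 2)) ≤ S := hmax ht
    calc |u t - w t| = |u t - w t| * Real.exp (-(L * t ^ 2)) * Real.exp (L * t ^ 2) := by
          rw [mul_assoc, hexp, mul_one]
      _ ≤ _ := by gcongr
  have hderiv : ∀ t ∈ Ico 0 R, ‖du t - dw t‖ ≤ S * (L * t * Real.exp (L * t ^ 2)) := by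
    intro t ht
    rcases ht.1.eq_or_lt with h0 | h0
    · rw [← h0, hu.deriv_zero, hw.deriv_zero]
      simp
    have hint : ∀ {v : ℝ → ℝ}, ContinuousOn v (Ici 0) →
        IntervalIntegrable (fun s => s ^ n * f (v s)) volume 0 t := fun hv => by
      refine ContinuousOn.intervalIntegrable ?_
      rw [uIcc_of_le h0.le]
      exact (continuous_pow n).continuousOn.mul
        (hf.comp_continuousOn (hv.mono Icc_subset_Ici_self))
    have h1 : t ^ n * (du t - dw t) = ∫ s in (0 : ℝ)..t, s ^ n * (f (w s) - f (u s)) := by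
      simp_rw [mul_sub]
      rw [intervalIntegral.integral_sub (hint hw.continuousOn) (hint hu.continuousOn),
        hu.flux t h0, hw.flux t h0]
      ring
    have h2 := intervalIntegral.norm_integral_le_of_norm_le_const (a := (0 : ℝ)) (b := t)
      (C := t ^ n * (L * (S * Real.exp (L * t ^ 2))))
      (f := fun s => s ^ n * (f (w s) - f (u s))) fun s hs => by
        rw [uIoc_of_le h0.le] at hs
        have hsR : s ∈ Icc 0 R := ⟨hs.1.le, hs.2.trans ht.2.le⟩
        rw [Real.norm_eq_abs, abs_mul, abs_of_nonneg (pow_nonneg hs.1.le n), abs_sub_comm]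
        have h3 : |f (u s) - f (w s)| ≤ L * (S * Real.exp (L * t ^ 2)) := by
          refine (hlip _ (_root_.abs_le.1 (huB s hsR)) _ (_root_.abs_le.1 (hwB s hsR))).trans ?_
          gcongr
          refine (hle s hsR).trans ?_
          have := hs.1.le
          have := hs.2
          gcongr
        have := hs.1.le
        have := hs.2
        gcongr
    rw [← h1, norm_mul, Real.norm_eq_abs (t ^ n), abs_of_nonneg (pow_nonneg h0.le n), sub_zero,
      abs_of_pos h0] at h2
    refine le_of_mul_le_mul_left (h2.trans_eq ?_) (pow_pos h0 n)
    ring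
  have hB : ∀ x, HasDerivAt (fun x => |u 0 - w 0| + S * (Real.exp (L * x ^ 2) / 2))
      (S * (L * x * Real.exp (L * x ^ 2))) x := fun x => by
    refine ((((((hasDerivAt_pow 2 x).const_mul L).exp).div_const 2).const_mul S).const_add
      _).congr_deriv ?_
    simp only [Nat.cast_ofNat, Nat.add_one_sub_one, pow_one]
    ring
  have hmain := image_norm_le_of_norm_deriv_right_le_deriv_boundary hd
    (fun x hx => (hu.hasDerivWithinAt x hx.1).sub (hw.hasDerivWithinAt x hx.1))
    (by simpa using hS) hB hderiv hr₀
  have hS2 : S ≤ 2 * |u 0 - w 0| := by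
    have h1 : S ≤ (|u 0 - w 0| + S * (Real.exp (L * r₀ ^ 2) / 2)) *
        Real.exp (-(L * r₀ ^ 2)) := by
      change _ * _ ≤ _
      gcongr
      exact hmain
    have h2 : Real.exp (-(L * r₀ ^ 2)) ≤ 1 := Real.exp_le_one_iff.2 (by
      have := sq_nonneg r₀
      nlinarith)
    have h3 := mul_le_mul_of_nonneg_left h2 (abs_nonneg (u 0 - w 0))
    have h4 := hexp r₀
    have h5 : (|u 0 - w 0| + S * (Real.exp (L * r₀ ^ 2) / 2)) * Real.exp (-(L * r₀ ^ 2)) =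
        |u 0 - w 0| * Real.exp (-(L * r₀ ^ 2)) +
          S / 2 * (Real.exp (-(L * r₀ ^ 2)) * Real.exp (L * r₀ ^ 2)) := by ring
    rw [h5, h4] at h1
    linarith
  exact (hle r hr).trans (by gcongr)

theorem IsRadialSolution.continuousOn {N : ℕ} {f w : ℝ → ℝ} {α : ℝ}
    (h : IsRadialSolution N f α w) : ContinuousOn w (Ici 0) := fun r hr => by
  rcases (mem_Ici.1 hr).eq_or_lt with h0 | h0
  · rw [← h0]
    exact h.initial_slope.continuousWithinAt
  · exact (h.differentiable r h0).continuousAt.continuousWithinAt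

/-- The quantity r^n w' + ∫₀^r t^n f(w) has zero derivative on (0, ∞). Its constant value is 0 even
though w' is not assumed continuous at 0: bounded values of w' along points accumulating at 0
suffice. -/
theorem IsRadialSolution.flux {n : ℕ} (hn : n ≠ 0) {f w : ℝ → ℝ} {α : ℝ} (hf : Continuous f)
    (h : IsRadialSolution (n + 1) f α w) {r : ℝ} (hr : 0 < r) :
    r ^ n * deriv w r = -∫ t in (0 : ℝ)..r, t ^ n * f (w t) := by
  have hwc : Continuous fun t => t ^ n * f (w |t|) :=
    (continuous_pow n).mul (hf.comp (h.continuousOn.comp_continuous continuous_abs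
      fun x => mem_Ici.2 (abs_nonneg x)))
  set J : ℝ → ℝ := fun r => ∫ t in (0 : ℝ)..r, t ^ n * f (w |t|)
  have hJ : ∀ r, HasDerivAt J (r ^ n * f (w |r|)) r := fun r =>
    (hwc.integral_hasStrictDerivAt 0 r).hasDerivAt
  have hJr : ∀ r, 0 < r → J r = ∫ t in (0 : ℝ)..r, t ^ n * f (w t) := fun r hr => by
    refine intervalIntegral.integral_congr fun t ht => ?_
    rw [uIcc_of_le hr.le] at ht
    simp only [abs_of_nonneg ht.1]
  set P : ℝ → ℝ := fun r => r ^ n * deriv w r + J r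
  have hP : ∀ r, 0 < r → HasDerivAt P 0 r := fun r hr => by
    refine (((hasDerivAt_pow n r).mul (h.deriv_differentiable r hr).hasDerivAt).add
      (hJ r)).congr_deriv ?_
    have h1 := h.equation r hr
    have h2 : (n : ℝ) * r ^ (n - 1) = n * r ^ n / r := by
      rcases n with _ | k
      · simp
      · rw [Nat.add_sub_cancel, pow_succ]
        field_simp
    have h3 : deriv (deriv w) r = -(n / r * deriv w r) - f (w r) := by
      push_cast at h1
      rw [add_sub_cancel_right] at h1
      linarith
    rw [h2, h3, abs_of_pos hr]
    field_simp
    ring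
  have hconst : ∀ s, 0 < s → P s = P r := fun s hs =>
    (convex_Ioi (0 : ℝ)).is_const_of_fderivWithin_eq_zero (𝕜 := ℝ)
      (fun x hx => (hP x hx).differentiableAt.differentiableWithinAt)
      (fun x hx => by
        rw [fderivWithin_of_isOpen isOpen_Ioi hx]
        ext
        simp [(hP x hx).deriv]) hs hr
  -- The slope at `0` provides points accumulating at `0` where `deriv w` is bounded by `1`.
  have hfreq : ∃ᶠ s in 𝓝[>] (0 : ℝ), |deriv w s| ≤ 1 := by
    rw [frequently_iff]
    intro U hU
    obtain ⟨a, ha, haU⟩ := mem_nhdsGT_iff_exists_Ioo_subset.1 hU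
    have hslope := ((hasDerivWithinAt_iff_tendsto_slope' (by simp)).1
      (h.initial_slope.mono Ioi_subset_Ici_self)).eventually
      (Metric.ball_mem_nhds (0 : ℝ) one_pos)
    obtain ⟨b, hb1, hb⟩ := (hslope.and (Ioo_mem_nhdsGT ha)).exists
    obtain ⟨c, hc, hcs⟩ := exists_hasDerivAt_eq_slope w (deriv w) hb.1
      (h.continuousOn.mono Icc_subset_Ici_self)
      fun x hx => (h.differentiable x hx.1).hasDerivAt
    refine ⟨c, haU ⟨hc.1, hc.2.trans hb.2⟩, ?_⟩
    rw [hcs, ← slope_def_field]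
    simpa using (mem_ball_zero_iff.1 hb1).le
  have hPr : P r = 0 := by
    by_contra hne
    have hlim : Tendsto (fun s : ℝ => |s| ^ n + |J s|) (𝓝[>] 0) (𝓝 0) := by
      have hc : Continuous fun s : ℝ => |s| ^ n + |J s| := by
        have : Continuous J := continuous_iff_continuousAt.2 fun x => (hJ x).continuousAt
        fun_prop
      have := hc.tendsto 0
      simp only [abs_zero, ne_eq, hn, not_false_eq_true, zero_pow, zero_add] at this
      rw [show J 0 = 0 from intervalIntegral.integral_same, abs_zero] at this
      exact this.mono_left nhdsWithin_le_nhds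
    obtain ⟨s, hs1, hs2, hs3⟩ := (hfreq.and_eventually
      ((hlim.eventually (gt_mem_nhds (abs_pos.2 hne))).and self_mem_nhdsWithin)).exists
    rw [← hconst s hs3] at hs2
    have h1 : |P s| ≤ |s| ^ n * |deriv w s| + |J s| := by
      rw [← abs_pow, ← abs_mul]
      exact abs_add_le _ _
    have h2 := mul_le_mul_of_nonneg_left hs1 (pow_nonneg (abs_nonneg s) n)
    linarith
  have h1 : r ^ n * deriv w r + J r = 0 := hPr
  rw [← hJr r hr]
  linarith

/-- The slope at 0 is inserted by hand, because `deriv w 0` is two-sided and depends on the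
irrelevant values of w at negative arguments. -/
theorem IsRadialSolution.integralSolution {n : ℕ} (hn : n ≠ 0) {f w : ℝ → ℝ} {α : ℝ}
    (hf : Continuous f) (h : IsRadialSolution (n + 1) f α w) :
    IntegralSolution n f w (fun r => if r = 0 then 0 else deriv w r) where
  hasDerivWithinAt r hr := by
    rcases hr.eq_or_lt with h0 | h0
    · rw [← h0, if_pos rfl]
      exact h.initial_slope
    · rw [if_neg h0.ne']
      exact (h.differentiable r h0).hasDerivAt.hasDerivWithinAt
  continuousOn := h.continuousOn
  deriv_zero := if_pos rfl
  flux r hr := by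
    rw [if_neg hr.ne']
    exact h.flux hn hf hr

theorem RegularSolution.eqOn_of_isRadialSolution {n : ℕ} (hn : n ≠ 0) {f u du w : ℝ → ℝ} {α : ℝ}
    (hf : IsNonlinearity f) (hu : RegularSolution n f α u du)
    (hw : IsRadialSolution (n + 1) f α w) : EqOn w u (Ici 0) := fun r hr => by
  obtain ⟨B₁, hB₁⟩ := (isCompact_Icc (a := 0) (b := r)).exists_bound_of_continuousOn
    hu.continuous.continuousOn
  obtain ⟨B₂, hB₂⟩ := (isCompact_Icc (a := 0) (b := r)).exists_bound_of_continuousOn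
    (hw.continuousOn.mono Icc_subset_Ici_self)
  obtain ⟨L, hL, hlip⟩ := hf.exists_lipschitz (max B₁ B₂)
  have h := (hw.integralSolution hn hf.continuous).abs_sub_le hu.integralSolution hf.continuous hL
    hlip (fun s hs => (hB₂ s hs).trans (le_max_right _ _))
    (fun s hs => (hB₁ s hs).trans (le_max_left _ _)) (r := r) ⟨hr, le_rfl⟩
  rw [hw.initial_value, hu.initial, sub_self, abs_zero, mul_zero, zero_mul] at h
  exact sub_eq_zero.1 (abs_nonpos_iff.1 h)

/-! ### Radial test functions -/

section Radial

variable {E : Type*} [NormedAddCommGroup E] [InnerProductSpace ℝ E] {χ χ' : ℝ → ℝ}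

/-- At the origin the norm is not differentiable; its default `fderiv` is harmless there because it
is multiplied by χ'(0) = 0. -/
theorem hasFDerivAt_comp_norm (hχ : ∀ r, HasDerivAt χ (χ' r) r) (h0 : χ' 0 = 0) (x : E) :
    HasFDerivAt (fun y : E => χ ‖y‖) (χ' ‖x‖ • fderiv ℝ (fun y : E => ‖y‖) x) x := by
  rcases eq_or_ne x 0 with rfl | hx
  · rw [norm_zero, h0, zero_smul, hasFDerivAt_iff_isLittleO_nhds_zero]
    have h1 := hasDerivAt_iff_isLittleO_nhds_zero.1 (hχ 0)
    rw [h0] at h1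
    have h2 := h1.comp_tendsto (tendsto_norm_zero (E := E))
    rw [← Asymptotics.isLittleO_norm_right]
    simpa [Function.comp_def] using h2
  · have h1 : DifferentiableAt ℝ (fun y : E => ‖y‖) x :=
      (contDiffAt_norm ℝ (n := 1) hx).differentiableAt one_ne_zero
    exact (hχ ‖x‖).comp_hasFDerivAt x h1.hasFDerivAt

theorem norm_smul_fderiv_norm (h0 : χ' 0 = 0) (x : E) :
    ‖χ' ‖x‖ • fderiv ℝ (fun y : E => ‖y‖) x‖ = |χ' ‖x‖| := by
  rcases eq_or_ne x 0 with rfl | hx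
  · simp [h0]
  · have : Nontrivial E := ⟨x, 0, hx⟩
    rw [norm_smul, norm_fderiv_norm, mul_one, Real.norm_eq_abs]
    exact (contDiffAt_norm ℝ (n := 1) hx).differentiableAt one_ne_zero

theorem contDiff_comp_norm (hχ : ∀ r, HasDerivAt χ (χ' r) r) (hc : Continuous χ')
    (h0 : χ' 0 = 0) : ContDiff ℝ 1 (fun y : E => χ ‖y‖) := by
  have hχc : ContDiff ℝ 1 χ := by
    rw [contDiff_one_iff_deriv, show deriv χ = χ' from funext fun r => (hχ r).deriv]
    exact ⟨fun r => (hχ r).differentiableAt, hc⟩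
  rw [contDiff_one_iff_fderiv]
  refine ⟨fun x => (hasFDerivAt_comp_norm hχ h0 x).differentiableAt, ?_⟩
  rw [continuous_iff_continuousAt]
  intro x
  rcases eq_or_ne x 0 with rfl | hx
  · rw [show fderiv ℝ (fun y : E => χ ‖y‖) = _ from
      funext fun x => (hasFDerivAt_comp_norm hχ h0 x).fderiv]
    have h1 : Tendsto (fun x : E => |χ' ‖x‖|) (𝓝 0) (𝓝 0) := by
      have := (hc.comp (continuous_norm (E := E))).abs.tendsto 0
      simpa [h0] using this
    unfold ContinuousAt
    simp only [norm_zero, h0, zero_smul]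
    rw [tendsto_zero_iff_norm_tendsto_zero]
    simpa only [norm_smul_fderiv_norm h0] using h1
  · have h1 : ContDiffAt ℝ 1 (fun y : E => χ ‖y‖) x :=
      hχc.contDiffAt.comp x (contDiffAt_norm ℝ hx)
    exact (h1.fderiv_right (m := 0) (by norm_num)).continuousAt

theorem norm_gradient_comp_norm [CompleteSpace E] (hχ : ∀ r, HasDerivAt χ (χ' r) r)
    (h0 : χ' 0 = 0) (x : E) : ‖gradient (fun y : E => χ ‖y‖) x‖ = |χ' ‖x‖| := by
  rw [gradient, LinearIsometryEquiv.norm_map, (hasFDerivAt_comp_norm hχ h0 x).fderiv,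
    norm_smul_fderiv_norm h0]

end Radial

theorem hasDerivAt_truncate {g g' : ℝ → ℝ} {R : ℝ} (hg : ∀ r, HasDerivAt g (g' r) r)
    (hR : g R = 0) (hR' : g' R = 0) (r : ℝ) :
    HasDerivAt (fun r => if r ≤ R then g r else 0) (if r ≤ R then g' r else 0) r := by
  rcases lt_trichotomy r R with h | h | h
  · rw [if_pos h.le]
    refine (hg r).congr_of_eventuallyEq ?_
    filter_upwards [gt_mem_nhds h] with s hs
    rw [if_pos (le_of_lt hs)]
  · subst h
    rw [if_pos le_rfl, hR', ← hasDerivWithinAt_univ, ← Iic_union_Ici (a := r)]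
    refine HasDerivWithinAt.union ?_ ?_
    · rw [← hR']
      exact (hg r).hasDerivWithinAt.congr (fun s hs => if_pos hs) (if_pos le_rfl)
    · refine (hasDerivWithinAt_const r (Ici r) (0 : ℝ)).congr (fun s hs => ?_) (by simp [hR])
      rcases (mem_Ici.1 hs).eq_or_lt with h1 | h1
      · simp [← h1, hR]
      · exact if_neg h1.not_ge
  · rw [if_neg h.not_ge]
    refine (hasDerivAt_const r (0 : ℝ)).congr_of_eventuallyEq ?_
    filter_upwards [lt_mem_nhds h] with s hs
    rw [if_neg (not_le.2 hs)]

theorem IsRadiallyStable.integral_nonneg_of_flat {n : ℕ} {f w : ℝ → ℝ}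
    (hs : IsRadiallyStable (n + 1) f w) {g g' : ℝ → ℝ} {R : ℝ} (hRpos : 0 ≤ R)
    (hg : ∀ r, HasDerivAt g (g' r) r) (hc : Continuous g') (h0 : g' 0 = 0) (hR : g R = 0)
    (hR' : g' R = 0) :
    0 ≤ ∫ r in (0 : ℝ)..R, r ^ n * (g' r ^ 2 - deriv f (w r) * g r ^ 2) := by
  set χ : ℝ → ℝ := fun r => if r ≤ R then g r else 0
  set χ' : ℝ → ℝ := fun r => if r ≤ R then g' r else 0
  have hχ : ∀ r, HasDerivAt χ (χ' r) r := hasDerivAt_truncate hg hR hR'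
  have hχc : Continuous χ' := Continuous.if_le hc continuous_const continuous_id continuous_const
    fun x hx => by rw [show x = R from hx, hR']
  have hχ0 : χ' 0 = 0 := by simp [χ', h0]
  have h1 := hs (fun x => χ ‖x‖) (contDiff_comp_norm hχ hχc hχ0) (by
    refine HasCompactSupport.intro (isCompact_closedBall 0 R) fun x hx => if_neg ?_
    simpa using hx)
  simp only [norm_gradient_comp_norm hχ hχ0, sq_abs] at h1
  rw [integral_fun_norm_addHaar volume fun r => χ' r ^ 2 - deriv f (w r) * χ r ^ 2,
    finrank_euclideanSpace, Fintype.card_fin, Nat.add_sub_cancel, nsmul_eq_mul, smul_eq_mul] at h1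
  have hball : 0 < volume.real (Metric.ball (0 : EuclideanSpace ℝ (Fin (n + 1))) 1) :=
    ENNReal.toReal_pos (Metric.measure_ball_pos _ _ one_pos).ne' measure_ball_lt_top.ne
  have h2 : 0 ≤ ∫ r in Ioi (0 : ℝ), r ^ n • (χ' r ^ 2 - deriv f (w r) * χ r ^ 2) :=
    nonneg_of_mul_nonneg_right (a := ((n + 1 : ℕ) : ℝ) *
      volume.real (Metric.ball (0 : EuclideanSpace ℝ (Fin (n + 1))) 1)) (by rwa [mul_assoc])
      (by positivity)
  rw [intervalIntegral.integral_of_le hRpos]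
  rw [setIntegral_eq_of_subset_of_forall_sdiff_eq_zero measurableSet_Ioi
    (Ioc_subset_Ioi_self : Ioc (0 : ℝ) R ⊆ Ioi 0)] at h2
  · refine h2.trans_eq (setIntegral_congr_fun measurableSet_Ioc fun r hr => ?_)
    simp only [χ, χ', if_pos hr.2, smul_eq_mul]
  · intro r hr
    have : ¬ r ≤ R := fun h => hr.2 ⟨hr.1, h⟩
    simp [χ, χ', this]

/-- When g'(R) ≠ 0, extending g by zero does not give a C¹ function. The functions √(g² + δ²) - δ
vanish at R together with their slope, have slope at most |g'|, and tend to |g| as δ → 0. -/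
theorem IsRadiallyStable.integral_nonneg {n : ℕ} {f w : ℝ → ℝ}
    (hs : IsRadiallyStable (n + 1) f w) (hw : Continuous fun r => deriv f (w r))
    {g g' : ℝ → ℝ} {R : ℝ} (hRpos : 0 ≤ R) (hg : ∀ r, HasDerivAt g (g' r) r)
    (hc : Continuous g') (h0 : g' 0 = 0) (hR : g R = 0) :
    0 ≤ ∫ r in (0 : ℝ)..R, r ^ n * (g' r ^ 2 - deriv f (w r) * g r ^ 2) := by
  have hgc : Continuous g := continuous_iff_continuousAt.2 fun r => (hg r).continuousAt
  set K : ℝ → ℝ := fun δ => ∫ r in (0 : ℝ)..R, r ^ n *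
    (g' r ^ 2 - deriv f (w r) * (Real.sqrt (g r ^ 2 + δ ^ 2) - δ) ^ 2)
  have hKc : Continuous K := by
    refine intervalIntegral.continuous_parametric_intervalIntegral_of_continuous' ?_ 0 R
    unfold Function.uncurry
    have : Continuous fun p : ℝ × ℝ => deriv f (w p.2) := hw.comp continuous_snd
    fun_prop
  have hKpos : ∀ δ, 0 < δ → 0 ≤ K δ := fun δ hδ => by
    have hpos : ∀ r, 0 < g r ^ 2 + δ ^ 2 := fun r => by positivity
    have hd : ∀ r, HasDerivAt (fun r => Real.sqrt (g r ^ 2 + δ ^ 2) - δ)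
        (g r * g' r / Real.sqrt (g r ^ 2 + δ ^ 2)) r := fun r => by
      refine (((((hg r).pow 2).add_const (δ ^ 2)).sqrt (hpos r).ne').sub_const δ).congr_deriv ?_
      simp only [Nat.cast_ofNat, Nat.add_one_sub_one, pow_one, Pi.pow_apply]
      rw [mul_assoc, mul_div_mul_left _ _ two_ne_zero]
    have hdc : Continuous fun r => g r * g' r / Real.sqrt (g r ^ 2 + δ ^ 2) :=
      (hgc.mul hc).div (by fun_prop) fun r => (Real.sqrt_pos.2 (hpos r)).ne'
    have h1 := hs.integral_nonneg_of_flat hRpos hd hdc (by simp [h0])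
      (by simp [hR, Real.sqrt_sq hδ.le]) (by simp [hR])
    refine h1.trans (intervalIntegral.integral_mono_on hRpos ?_ ?_ fun r hr => ?_)
    · exact Continuous.intervalIntegrable (by fun_prop) _ _
    · exact Continuous.intervalIntegrable (by fun_prop) _ _
    · refine mul_le_mul_of_nonneg_left (sub_le_sub_right ?_ _) (pow_nonneg hr.1 n)
      rw [div_pow, Real.sq_sqrt (hpos r).le, div_le_iff₀ (hpos r)]
      nlinarith [sq_nonneg (g' r), sq_nonneg δ, mul_nonneg (sq_nonneg (g' r)) (sq_nonneg δ)]
  have h1 : 0 ≤ K 0 := ge_of_tendsto ((hKc.tendsto 0).mono_left (nhdsWithin_le_nhds (s := Ioi 0)))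
    (eventually_nhdsWithin_of_forall fun δ hδ => hKpos δ hδ)
  simpa [K, Real.sqrt_sq_eq_abs] using h1

/-! ### Ordering of stable solutions -/

theorem IsNonlinearity.deriv_le_deriv {f : ℝ → ℝ} (hf : IsNonlinearity f) {x y : ℝ}
    (h : |x| ≤ |y|) : deriv f x ≤ deriv f y := by
  rw [← hf.deriv_abs x, ← hf.deriv_abs y]
  exact (hf.strictMonoOn_deriv.le_iff_le (mem_Ici.2 (abs_nonneg x))
    (mem_Ici.2 (abs_nonneg y))).2 h

/-- Integration by parts gives ∫ r^n (ψ'² - hψ) = 0 over [0, R], so h < f'(w) ψ makes the quadratic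
form negative at ψ. -/
theorem IsRadiallyStable.false_of_subsolution {n : ℕ} {f w : ℝ → ℝ}
    (hs : IsRadiallyStable (n + 1) f w) (hw : Continuous fun r => deriv f (w r))
    {ψ dψ h : ℝ → ℝ} {R : ℝ} (hR : 0 < R) (hψ : ∀ r, HasDerivAt ψ (dψ r) r)
    (hc : Continuous dψ) (h0 : dψ 0 = 0) (hψR : ψ R = 0) (hh : Continuous h)
    (hflux : ∀ r, HasDerivAt (fun s => s ^ n * dψ s) (-(r ^ n * h r)) r)
    (hpos : ∀ r ∈ Ioo 0 R, 0 < ψ r) (hlt : ∀ r ∈ Ioo 0 R, h r < deriv f (w r) * ψ r) : False := by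
  have hψc : Continuous ψ := continuous_iff_continuousAt.2 fun r => (hψ r).continuousAt
  have h1 := hs.integral_nonneg hw hR.le hψ hc h0 hψR
  have h2 : ∫ r in (0 : ℝ)..R, (-(r ^ n * h r) * ψ r + r ^ n * dψ r * dψ r) = 0 := by
    rw [intervalIntegral.integral_eq_sub_of_hasDerivAt
      (f := fun s => s ^ n * dψ s * ψ s) (fun r _ => (hflux r).mul (hψ r))
      (Continuous.intervalIntegrable (by fun_prop) _ _), h0, hψR]
    simp
  have h3 : 0 < ∫ r in (0 : ℝ)..R, r ^ n * ψ r * (deriv f (w r) * ψ r - h r) :=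
    intervalIntegral.intervalIntegral_pos_of_pos_on
      (Continuous.intervalIntegrable (by fun_prop) _ _) (fun r hr =>
        mul_pos (mul_pos (pow_pos hr.1 n) (hpos r hr)) (sub_pos.2 (hlt r hr))) hR
  have h4 : ∫ r in (0 : ℝ)..R, r ^ n * (dψ r ^ 2 - deriv f (w r) * ψ r ^ 2) =
      (∫ r in (0 : ℝ)..R, (-(r ^ n * h r) * ψ r + r ^ n * dψ r * dψ r)) -
      ∫ r in (0 : ℝ)..R, r ^ n * ψ r * (deriv f (w r) * ψ r - h r) := by
    rw [← intervalIntegral.integral_sub]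
    · congr 1
      ext r
      ring
    · exact Continuous.intervalIntegrable (by fun_prop) _ _
    · exact Continuous.intervalIntegrable (by fun_prop) _ _
  rw [h4, h2] at h1
  linarith

theorem RegularSolution.pos_and_lt_of_stable {n : ℕ} {f u du v dv : ℝ → ℝ} {α β : ℝ}
    (hf : IsNonlinearity f) (hu : RegularSolution n f α u du) (hv : RegularSolution n f β v dv)
    (hs : IsRadiallyStable (n + 1) f u) (hβ : 0 < β) (hβα : β < α) (r : ℝ) :
    0 < v r ∧ v r < u r := by
  have huc := hu.continuous
  have hvc := hv.continuous
  have hVc : Continuous fun r => deriv f (u r) := hf.continuous_deriv.comp huc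
  rw [← hu.apply_abs, ← hv.apply_abs]
  by_contra hr
  -- R = inf Z is the first radius where 0 < v < u fails. If v(R) = 0 the test function is v, as
  -- f(v) < f'(v) v ≤ f'(u) v; if v(R) = u(R) it is u - v, as f(u) - f(v) < f'(u) (u - v).
  set Z : Set ℝ := Ici 0 ∩ {s | v s ≤ 0 ∨ u s ≤ v s}
  have hZc : IsClosed Z :=
    isClosed_Ici.inter ((isClosed_le hvc continuous_const).union (isClosed_le huc hvc))
  have hZne : Z.Nonempty := ⟨|r|, abs_nonneg r, by
    rw [not_and_or, not_lt, not_lt] at hr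
    exact hr⟩
  have hZb : BddBelow Z := ⟨0, fun s hs => hs.1⟩
  set R := sInf Z
  have hRZ : R ∈ Z := hZc.csInf_mem hZne hZb
  have hR : 0 < R := by
    rcases (mem_Ici.1 hRZ.1).eq_or_lt with h0 | h0
    · have h1 := hRZ.2
      rw [← h0] at h1
      simp only [mem_ofPred_eq, hu.initial, hv.initial] at h1
      rcases h1 with h1 | h1 <;> linarith
    · exact h0
  have hbefore : ∀ s ∈ Ioo 0 R, 0 < v s ∧ v s < u s := fun s hs => by
    have h1 : s ∉ Z := notMem_of_lt_csInf hs.2 hZb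
    by_contra h2
    rw [not_and_or, not_lt, not_lt] at h2
    exact h1 ⟨hs.1.le, h2⟩
  have hev : ∀ᶠ s in 𝓝[<] R, s ∈ Ioo 0 R := Ioo_mem_nhdsLT hR
  have hvR : 0 ≤ v R := ge_of_tendsto ((hvc.tendsto R).mono_left nhdsWithin_le_nhds)
    (hev.mono fun s hs => (hbefore s hs).1.le)
  have hvuR : v R ≤ u R := le_of_tendsto_of_tendsto
    ((hvc.tendsto R).mono_left nhdsWithin_le_nhds) ((huc.tendsto R).mono_left nhdsWithin_le_nhds)
    (hev.mono fun s hs => (hbefore s hs).2.le)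
  rcases hRZ.2 with h1 | h1
  · refine hs.false_of_subsolution hVc (h := fun s => f (v s)) hR hv.hasDerivAt hv.continuous_deriv
      hv.deriv_zero (le_antisymm h1 hvR) (hf.continuous.comp hvc)
      (hv.hasDerivAt_flux hf.continuous) (fun s hs => (hbefore s hs).1) fun s hs => ?_
    obtain ⟨h2, h3⟩ := hbefore s hs
    have h4 := hf.sub_lt_deriv_mul le_rfl h2
    rw [hf.map_zero, sub_zero, sub_zero] at h4
    refine h4.trans_le (mul_le_mul_of_nonneg_right (hf.deriv_le_deriv ?_) h2.le)
    rw [abs_of_pos h2, abs_of_pos (h2.trans h3)]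
    exact h3.le
  · refine hs.false_of_subsolution hVc (ψ := fun s => u s - v s) (h := fun s => f (u s) - f (v s))
      hR (fun s => (hu.hasDerivAt s).sub (hv.hasDerivAt s))
      (hu.continuous_deriv.sub hv.continuous_deriv) (by simp [hu.deriv_zero, hv.deriv_zero])
      (sub_eq_zero.2 (le_antisymm h1 hvuR))
      ((hf.continuous.comp huc).sub (hf.continuous.comp hvc)) (fun s => ?_)
      (fun s hs => sub_pos.2 (hbefore s hs).2) fun s hs => ?_
    · have h2 := (hu.hasDerivAt_flux hf.continuous s).sub (hv.hasDerivAt_flux hf.continuous s)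
      refine (h2.congr_deriv (by ring)).congr_of_eventuallyEq (Eventually.of_forall fun t => ?_)
      simp only [Pi.sub_apply]
      ring
    · obtain ⟨h2, h3⟩ := hbefore s hs
      exact hf.sub_lt_deriv_mul h2.le h3

/-! ### Monotonicity of stability in the potential. -/

theorem continuous_gradient {E : Type*} [NormedAddCommGroup E] [InnerProductSpace ℝ E]
    [CompleteSpace E] {φ : E → ℝ} (hφ : ContDiff ℝ 1 φ) : Continuous (gradient φ) :=
  (InnerProductSpace.toDual ℝ E).symm.continuous.comp (hφ.continuous_fderiv one_ne_zero)

theorem integrable_norm_gradient_sq {N : ℕ} {φ : EuclideanSpace ℝ (Fin N) → ℝ}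
    (hφ : ContDiff ℝ 1 φ) (hc : HasCompactSupport φ) :
    Integrable fun x => ‖gradient φ x‖ ^ 2 := by
  refine ((continuous_gradient hφ).norm.pow 2).integrable_of_hasCompactSupport ?_
  refine (hc.fderiv (𝕜 := ℝ)).mono fun x hx => ?_
  contrapose! hx
  simp only [Function.mem_support, not_not] at hx ⊢
  simp [gradient, hx]

theorem integrable_mul_sq {N : ℕ} {V φ : EuclideanSpace ℝ (Fin N) → ℝ} (hV : Continuous V)
    (hφ : Continuous φ) (hc : HasCompactSupport φ) : Integrable fun x => V x * φ x ^ 2 := by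
  refine (hV.mul (hφ.pow 2)).integrable_of_hasCompactSupport ?_
  refine hc.mono fun x hx => ?_
  contrapose! hx
  simp only [Function.mem_support, not_not] at hx ⊢
  simp [hx]

theorem IsRadiallyStable.of_deriv_le {N : ℕ} {f u v : ℝ → ℝ} (hs : IsRadiallyStable N f u)
    (hf : IsNonlinearity f) (hu : Continuous u) (hv : Continuous v)
    (h : ∀ r, deriv f (v r) ≤ deriv f (u r)) : IsRadiallyStable N f v := by
  intro φ hφ hc
  have hd := hf.continuous_deriv
  refine (hs φ hφ hc).trans (integral_mono ?_ ?_ fun x => ?_)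
  · exact (integrable_norm_gradient_sq hφ hc).sub
      (integrable_mul_sq (by fun_prop) hφ.continuous hc)
  · exact (integrable_norm_gradient_sq hφ hc).sub
      (integrable_mul_sq (by fun_prop) hφ.continuous hc)
  · exact sub_le_sub_left (mul_le_mul_of_nonneg_right (h ‖x‖) (sq_nonneg _)) _

/-! ### The set of stable initial values and the two structures. -/

section Family

variable {n : ℕ} {f : ℝ → ℝ} {u du : ℝ → ℝ → ℝ}

theorem isRadiallyStable_of_lt (hf : IsNonlinearity f)
    (hu : ∀ α, 0 < α → RegularSolution n f α (u α) (du α)) {α β : ℝ} (hβ : 0 < β) (hβα : β < α)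
    (hs : IsRadiallyStable (n + 1) f (u α)) : IsRadiallyStable (n + 1) f (u β) := by
  have hα := hβ.trans hβα
  refine hs.of_deriv_le hf (hu α hα).continuous (hu β hβ).continuous fun r => ?_
  obtain ⟨h1, h2⟩ := (hu α hα).pos_and_lt_of_stable hf (hu β hβ) hs hβ hβα r
  refine hf.deriv_le_deriv ?_
  rw [abs_of_pos h1, abs_of_pos (h1.trans h2)]
  exact h2.le

theorem tendsto_apply (hf : IsNonlinearity f)
    (hu : ∀ α, 0 < α → RegularSolution n f α (u α) (du α)) (hb : ∀ α, 0 < α → ∀ r, |u α r| ≤ α)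
    {α : ℝ} (hα : 0 < α) {a : ℕ → ℝ} (ha : ∀ k, 0 < a k) (haα : ∀ k, a k ≤ α)
    (hlim : Tendsto a atTop (𝓝 α)) {r : ℝ} (hr : 0 ≤ r) :
    Tendsto (fun k => u (a k) r) atTop (𝓝 (u α r)) := by
  obtain ⟨L, hL, hlip⟩ := hf.exists_lipschitz α
  rw [tendsto_iff_norm_sub_tendsto_zero]
  have hbound : ∀ k, ‖u (a k) r - u α r‖ ≤ 2 * |a k - α| * Real.exp (L * r ^ 2) := fun k => by
    have h := (hu _ (ha k)).integralSolution.abs_sub_le (hu α hα).integralSolution hf.continuous hL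
      hlip (R := r) (fun s _ => (hb _ (ha k) s).trans (haα k)) (fun s _ => hb α hα s) ⟨hr, le_rfl⟩
    rwa [(hu _ (ha k)).initial, (hu α hα).initial] at h
  refine squeeze_zero (fun k => norm_nonneg _) hbound ?_
  have h1 : Tendsto (fun k => |a k - α|) atTop (𝓝 0) := by
    simpa using (hlim.sub_const α).abs
  simpa using (h1.const_mul 2).mul_const (Real.exp (L * r ^ 2))

/-- Dominated convergence along a sequence increasing to α: all the potentials lie between 0 and
f'(α), because |u(r, β)| ≤ β < α. -/
theorem isRadiallyStable_of_forall_lt (hf : IsNonlinearity f)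
    (hu : ∀ α, 0 < α → RegularSolution n f α (u α) (du α)) (hb : ∀ α, 0 < α → ∀ r, |u α r| ≤ α)
    {α : ℝ} (hα : 0 < α)
    (hs : ∀ β, 0 < β → β < α → IsRadiallyStable (n + 1) f (u β)) :
    IsRadiallyStable (n + 1) f (u α) := by
  intro φ hφ hc
  have hd := hf.continuous_deriv
  obtain ⟨a, _, ha, hlim⟩ := exists_seq_strictMono_tendsto' hα
  have hG := integrable_norm_gradient_sq hφ hc
  have hφ2 : Integrable fun x => deriv f α * φ x ^ 2 :=
    integrable_mul_sq continuous_const hφ.continuous hc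
  refine ge_of_tendsto' (tendsto_integral_of_dominated_convergence
    (F := fun k x => ‖gradient φ x‖ ^ 2 - deriv f (u (a k) ‖x‖) * φ x ^ 2)
    (fun x => ‖gradient φ x‖ ^ 2 + deriv f α * φ x ^ 2) (fun k => ?_) (hG.add hφ2) (fun k => ?_)
    ?_) fun k => hs (a k) (ha k).1 (ha k).2 φ hφ hc
  · have := (hu _ (ha k).1).continuous
    exact (hG.sub (integrable_mul_sq (V := fun x => deriv f (u (a k) ‖x‖)) (by fun_prop)
      hφ.continuous hc)).aestronglyMeasurable
  · refine Eventually.of_forall fun x => ?_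
    have h1 : deriv f (u (a k) ‖x‖) ≤ deriv f α := hf.deriv_le_deriv (by
      rw [abs_of_pos hα]
      exact (hb _ (ha k).1 _).trans (ha k).2.le)
    have h2 : 0 ≤ deriv f (u (a k) ‖x‖) := by
      rw [← hf.deriv_abs]
      rcases (abs_nonneg (u (a k) ‖x‖)).eq_or_lt with h | h
      -- Positivity of f' is assumed only away from 0; at 0 it gives f'(0) ≥ 0 by continuity.
      · exact ge_of_tendsto ((hd.tendsto _).mono_left (nhdsWithin_le_nhds (s := Ioi _)))
          (eventually_nhdsWithin_of_forall fun y hy => (hf.deriv_pos y (h.trans_lt hy)).le)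
      · exact (hf.deriv_pos _ h).le
    rw [Real.norm_eq_abs]
    refine (abs_sub _ _).trans ?_
    rw [abs_of_nonneg (sq_nonneg _), abs_of_nonneg (by positivity)]
    gcongr
  · refine Eventually.of_forall fun x => ?_
    exact ((hd.tendsto _).comp (tendsto_apply hf hu hb hα (fun k => (ha k).1) (fun k => (ha k).2.le)
      hlim (norm_nonneg x))).mul_const _ |>.const_sub _

theorem structureI_or_structureIII (hf : IsNonlinearity f)
    (hu : ∀ α, 0 < α → RegularSolution n f α (u α) (du α)) (hb : ∀ α, 0 < α → ∀ r, |u α r| ≤ α)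
    {αhat : ℝ} (hunst : ∀ α, αhat < α → ¬ IsRadiallyStable (n + 1) f (u α)) :
    StructureI (n + 1) f u ∨ StructureIII (n + 1) f u := by
  set S : Set ℝ := {α | 0 < α ∧ IsRadiallyStable (n + 1) f (u α)}
  rcases S.eq_empty_or_nonempty with hS | ⟨α₀, hα₀⟩
  · exact Or.inl fun α hα hs => (hS ▸ (⟨hα, hs⟩ : α ∈ S) : α ∈ (∅ : Set ℝ))
  · have hbdd : BddAbove S := ⟨αhat, fun α hα => not_lt.1 fun h => hunst α h hα.2⟩
    have hpos : 0 < sSup S := hα₀.1.trans_le (le_csSup hbdd hα₀)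
    have hlt : ∀ α, 0 < α → α < sSup S → IsRadiallyStable (n + 1) f (u α) := fun α hα h => by
      obtain ⟨β, hβ, hαβ⟩ := exists_lt_of_lt_csSup ⟨α₀, hα₀⟩ h
      exact isRadiallyStable_of_lt hf hu hα hαβ hβ.2
    refine Or.inr ⟨sSup S, hpos, fun α hα h => ?_, fun α h hs => ?_, fun r hr β hβ α hα h => ?_⟩
    · rcases h.eq_or_lt with rfl | h
      · exact isRadiallyStable_of_forall_lt hf hu hb hpos hlt
      · exact hlt α hα h
    · exact (le_csSup hbdd ⟨hpos.trans h, hs⟩).not_gt h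
    · exact ((hu α hα.1).pos_and_lt_of_stable hf (hu β hβ.1) (hlt α hα.1 hα.2) hβ.1 h r).2

end Family

/-! ### Integral estimates for the transformed profile

For a positive regular solution `u`, the function `v = F(u)` solves
`(r ^ n * v')' = r ^ n * (1 + f'(u) * v' ^ 2)`. -/

/-- A positive increasing `v` with derivative `dv` solving
`(r ^ n * v')' = r ^ n * (1 + P * v' ^ 2)`, for which the potential `P` is stable with respect to
radial test functions. -/
structure StableProfile (n : ℕ) (v dv P : ℝ → ℝ) (ε : ℝ) : Prop where
  initial : v 0 = ε
  hasDerivAt : ∀ r, HasDerivAt v (dv r) r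
  continuous_deriv : Continuous dv
  deriv_zero : dv 0 = 0
  pos : ∀ r, 0 < v r
  continuous_potential : Continuous P
  flux : ∀ r, HasDerivAt (fun s => s ^ n * dv s) (r ^ n * (1 + P r * dv r ^ 2)) r
  deriv_nonneg : ∀ r, 0 ≤ r → 0 ≤ dv r
  lower : ∀ r, 0 ≤ r → ε + r ^ 2 / (2 * (n + 1)) ≤ v r
  stable : ∀ (g g' : ℝ → ℝ) (R : ℝ), 0 ≤ R → (∀ r, HasDerivAt g (g' r) r) → Continuous g' →
    g' 0 = 0 → g R = 0 → 0 ≤ ∫ r in (0 : ℝ)..R, r ^ n * (g' r ^ 2 - P r * g r ^ 2)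

namespace StableProfile

variable {n : ℕ} {v dv P : ℝ → ℝ} {ε : ℝ}

theorem continuous (h : StableProfile n v dv P ε) : Continuous v :=
  continuous_iff_continuousAt.2 fun r => (h.hasDerivAt r).continuousAt

theorem continuous_rpow (h : StableProfile n v dv P ε) (p : ℝ) : Continuous fun r => v r ^ p :=
  h.continuous.rpow_const fun r => Or.inl (h.pos r).ne'

theorem hasDerivAt_rpow (h : StableProfile n v dv P ε) (p r : ℝ) :
    HasDerivAt (fun r => v r ^ p) (p * v r ^ (p - 1) * dv r) r :=
  ((h.hasDerivAt r).rpow_const (Or.inl (h.pos r).ne')).congr_deriv (by ring)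

theorem monotoneOn (h : StableProfile n v dv P ε) : MonotoneOn v (Ici 0) :=
  monotoneOn_of_deriv_nonneg (convex_Ici 0) h.continuous.continuousOn
    (fun r _ => (h.hasDerivAt r).differentiableAt.differentiableWithinAt) fun r hr => by
      rw [(h.hasDerivAt r).deriv]
      exact h.deriv_nonneg r (interior_subset hr)

/-- The equation is multiplied by v^(-2m-1) and integrated by parts; the boundary term vanishes at 0
and is nonnegative at ρ since v' ≥ 0. -/
theorem integral_energy_le (h : StableProfile n v dv P ε) {ρ k m : ℝ} (hρ : 0 ≤ ρ)
    (hk : ∀ r ∈ Icc 0 ρ, P r * v r ≤ k) :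
    (2 * m + 1 - k) * ∫ r in (0 : ℝ)..ρ, r ^ n * (v r ^ (-2 * m - 2) * dv r ^ 2) ≤
      ∫ r in (0 : ℝ)..ρ, r ^ n * v r ^ (-2 * m - 1) := by
  have hc1 := h.continuous_rpow (-2 * m - 1)
  have hc2 := h.continuous_rpow (-2 * m - 2)
  have hc3 := h.continuous_deriv
  have hc4 := h.continuous_potential
  have hd : ∀ r ∈ uIcc 0 ρ, HasDerivAt (fun s => s ^ n * dv s * v s ^ (-2 * m - 1))
      (r ^ n * (1 + P r * dv r ^ 2) * v r ^ (-2 * m - 1) +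
        r ^ n * dv r * ((-2 * m - 1) * v r ^ (-2 * m - 2) * dv r)) r := fun r _ => by
    have := (h.flux r).mul (h.hasDerivAt_rpow (-2 * m - 1) r)
    rwa [show -2 * m - 1 - 1 = -2 * m - 2 by ring] at this
  have h1 := intervalIntegral.integral_eq_sub_of_hasDerivAt hd
    (Continuous.intervalIntegrable (by fun_prop) _ _)
  have h2 : 0 ≤ ρ ^ n * dv ρ * v ρ ^ (-2 * m - 1) :=
    mul_nonneg (mul_nonneg (pow_nonneg hρ n) (h.deriv_nonneg ρ hρ))
      (Real.rpow_nonneg (h.pos ρ).le _)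
  rw [h.deriv_zero, mul_zero, zero_mul, sub_zero] at h1
  rw [← h1] at h2
  rw [← intervalIntegral.integral_const_mul, ← sub_nonneg, ← intervalIntegral.integral_sub
    (Continuous.intervalIntegrable (by fun_prop) _ _)
    (Continuous.intervalIntegrable (by fun_prop) _ _)]
  refine h2.trans (intervalIntegral.integral_mono_on hρ
    (Continuous.intervalIntegrable (by fun_prop) _ _)
    (Continuous.intervalIntegrable (by fun_prop) _ _) fun r hr => ?_)
  have h3 : v r ^ (-2 * m - 1) = v r ^ (-2 * m - 2) * v r := by
    rw [← Real.rpow_add_one (h.pos r).ne']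
    congr 1
    ring
  rw [h3]
  have h4 : 0 ≤ r ^ n * v r ^ (-2 * m - 2) * dv r ^ 2 * (k - P r * v r) :=
    mul_nonneg (mul_nonneg (mul_nonneg (pow_nonneg hr.1 n) (Real.rpow_nonneg (h.pos r).le _))
      (sq_nonneg _)) (sub_nonneg.2 (hk r hr))
  linarith

/-- Stability is tested with v^(-m) - A^(-m). In the expanded square, the nonnegative term A^(-2m)
is dropped. -/
theorem integral_potential_le (h : StableProfile n v dv P ε) {ρ l m A : ℝ} (hρ : 0 ≤ ρ)
    (hA : v ρ = A) (hl0 : 0 ≤ l) (hl : ∀ r ∈ Icc 0 ρ, l ≤ P r * v r) :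
    l * ((∫ r in (0 : ℝ)..ρ, r ^ n * v r ^ (-2 * m - 1)) -
        2 * A ^ (-m) * ∫ r in (0 : ℝ)..ρ, r ^ n * v r ^ (-m - 1)) ≤
      m ^ 2 * ∫ r in (0 : ℝ)..ρ, r ^ n * (v r ^ (-2 * m - 2) * dv r ^ 2) := by
  have hc1 := h.continuous_rpow (-2 * m - 1)
  have hc2 := h.continuous_rpow (-2 * m - 2)
  have hc3 := h.continuous_deriv
  have hc4 := h.continuous_potential
  have hc5 := h.continuous_rpow (-m - 1)
  have hc6 := h.continuous_rpow (-m)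
  have h1 := h.stable (fun r => v r ^ (-m) - A ^ (-m)) (fun r => -m * v r ^ (-m - 1) * dv r) ρ hρ
    (fun r => (h.hasDerivAt_rpow (-m) r).sub_const _) (by fun_prop) (by simp [h.deriv_zero])
    (by simp [hA])
  rw [← intervalIntegral.integral_const_mul, ← intervalIntegral.integral_const_mul,
    ← intervalIntegral.integral_sub (Continuous.intervalIntegrable (by fun_prop) _ _)
    (Continuous.intervalIntegrable (by fun_prop) _ _), ← intervalIntegral.integral_const_mul,
    ← sub_nonneg, ← intervalIntegral.integral_sub
    (Continuous.intervalIntegrable (by fun_prop) _ _)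
    (Continuous.intervalIntegrable (by fun_prop) _ _)]
  refine h1.trans (intervalIntegral.integral_mono_on hρ
    (Continuous.intervalIntegrable (by fun_prop) _ _)
    (Continuous.intervalIntegrable (by fun_prop) _ _) fun r hr => ?_)
  have hv := h.pos r
  have e1 : v r ^ (-m - 1) = v r ^ (-m) / v r := Real.rpow_sub_one hv.ne' _
  have e2 : v r ^ (-2 * m - 1) = (v r ^ (-m)) ^ 2 / v r := by
    rw [Real.rpow_sub_one hv.ne', ← Real.rpow_mul_natCast hv.le]
    congr 2
    push_cast
    ring
  have e3 : v r ^ (-2 * m - 2) = (v r ^ (-m) / v r) ^ 2 := by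
    rw [← e1, ← Real.rpow_mul_natCast hv.le]
    congr 1
    push_cast
    ring
  rw [e1, e2, e3]
  set a := v r ^ (-m)
  set c := A ^ (-m)
  have h2 : l / v r * (a ^ 2 - 2 * c * a) ≤ P r * (a - c) ^ 2 := by
    have h3 : l / v r ≤ P r := (div_le_iff₀ hv).2 (hl r hr)
    have h4 : 0 ≤ l / v r := by positivity
    nlinarith [mul_le_mul_of_nonneg_right h3 (sq_nonneg (a - c)), mul_nonneg h4 (sq_nonneg c)]
  have h3 := mul_le_mul_of_nonneg_left h2 (pow_nonneg hr.1 n)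
  have h4 : l / v r * (a ^ 2 - 2 * c * a) = l * (a ^ 2 / v r) - l * (2 * c * (a / v r)) := by
    ring
  rw [h4] at h3
  linarith

/-- The lower bound on v yields v ≥ (e + r)²/(4(n + 1)) with e = √ε, and the resulting power
integral converges at infinity since 2b > n + 1. -/
theorem integral_rpow_neg_le (h : StableProfile n v dv P ε) {e ρ b : ℝ} (he : 0 < e)
    (hε : ε = e ^ 2) (hρ : 0 ≤ ρ) (hb : (n + 1 : ℝ) < 2 * b) :
    ∫ r in (0 : ℝ)..ρ, r ^ n * v r ^ (-b) ≤
      (4 * (n + 1)) ^ b / (2 * b - (n + 1)) * e ^ ((n + 1 : ℝ) - 2 * b) := by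
  have hb0 : 0 < b := by
    have : (0 : ℝ) ≤ n := n.cast_nonneg
    linarith
  have hpos : ∀ r ∈ uIcc 0 ρ, 0 < e + r := fun r hr => by
    rw [uIcc_of_le hρ] at hr
    linarith [hr.1]
  have hcont : ContinuousOn (fun r => (e + r) ^ ((n : ℝ) - 2 * b)) (uIcc 0 ρ) :=
    (continuous_const.add continuous_id).continuousOn.rpow_const fun r hr => Or.inl (hpos r hr).ne'
  have hc := h.continuous_rpow (-b)
  have h1 : ∫ r in (0 : ℝ)..ρ, r ^ n * v r ^ (-b) ≤
      ∫ r in (0 : ℝ)..ρ, (4 * (n + 1)) ^ b * (e + r) ^ ((n : ℝ) - 2 * b) := by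
    refine intervalIntegral.integral_mono_on hρ (Continuous.intervalIntegrable (by fun_prop) _ _)
      (hcont.intervalIntegrable.const_mul _) fun r hr => ?_
    have her : 0 < e + r := by linarith [hr.1]
    have h2 : (e + r) ^ 2 / (4 * (n + 1)) ≤ v r := by
      refine le_trans ?_ (h.lower r hr.1)
      rw [hε, div_le_iff₀ (by positivity)]
      have h3 : (e ^ 2 + r ^ 2 / (2 * ((n : ℝ) + 1))) * (4 * (n + 1)) =
          4 * (n + 1) * e ^ 2 + 2 * r ^ 2 := by
        field_simp
        ring
      rw [h3]
      have : (0 : ℝ) ≤ n * e ^ 2 := by positivity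
      nlinarith [sq_nonneg (e - r)]
    have h3 : v r ^ (-b) ≤ ((e + r) ^ 2 / (4 * (n + 1))) ^ (-b) :=
      Real.rpow_le_rpow_of_nonpos (by positivity) h2 (by linarith)
    have h4 : ((e + r) ^ 2 / (4 * ((n : ℝ) + 1))) ^ (-b) =
        (4 * (n + 1)) ^ b * (e + r) ^ (-2 * b) := by
      rw [Real.div_rpow (by positivity) (by positivity),
        Real.rpow_neg (by positivity : (0 : ℝ) ≤ 4 * (n + 1)),
        div_inv_eq_mul, mul_comm, ← Real.rpow_natCast_mul her.le]
      congr 2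
      push_cast
      ring
    have h5 : r ^ n ≤ (e + r) ^ n := pow_le_pow_left₀ hr.1 (by linarith) n
    calc r ^ n * v r ^ (-b) ≤ (e + r) ^ n * ((4 * (n + 1)) ^ b * (e + r) ^ (-2 * b)) := by
          rw [← h4]
          have := Real.rpow_nonneg (h.pos r).le (-b)
          gcongr
      _ = (4 * (n + 1)) ^ b * ((e + r) ^ (n : ℝ) * (e + r) ^ (-2 * b)) := by
          rw [Real.rpow_natCast]
          ring
      _ = _ := by
          rw [← Real.rpow_add her]
          congr 2
          ring
  have h2 : ∫ r in (0 : ℝ)..ρ, (e + r) ^ ((n : ℝ) - 2 * b) =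
      (e ^ ((n + 1 : ℝ) - 2 * b) - (e + ρ) ^ ((n + 1 : ℝ) - 2 * b)) / (2 * b - (n + 1)) := by
    have hne : 2 * b - ((n : ℝ) + 1) ≠ 0 := by linarith
    have hd : ∀ r ∈ uIcc 0 ρ, HasDerivAt
        (fun r => -((e + r) ^ ((n + 1 : ℝ) - 2 * b) / (2 * b - (n + 1))))
        ((e + r) ^ ((n : ℝ) - 2 * b)) r := fun r hr => by
      refine ((((hasDerivAt_id r).const_add e).rpow_const (p := (n + 1 : ℝ) - 2 * b)
        (Or.inl (hpos r hr).ne')).div_const (2 * b - (n + 1))).neg.congr_deriv ?_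
      rw [show (n + 1 : ℝ) - 2 * b - 1 = n - 2 * b by ring]
      simp only [id]
      field_simp
      ring
    rw [intervalIntegral.integral_eq_sub_of_hasDerivAt hd hcont.intervalIntegrable, add_zero]
    ring
  rw [intervalIntegral.integral_const_mul, h2] at h1
  refine h1.trans ?_
  have h3 : 0 ≤ (e + ρ) ^ ((n + 1 : ℝ) - 2 * b) := Real.rpow_nonneg (by linarith) _
  have h4 : 0 < 2 * b - ((n : ℝ) + 1) := by linarith
  rw [div_mul_eq_mul_div, ← mul_div_assoc]
  gcongr
  linarith

/-- Integrating the bound on v' v^(-k) gives v^(1-k) ≥ ε^(1-k)/2 for r² ≤ (n + 1)ε/(k - 1): v stays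
comparable to ε up to radius of order √ε. -/
theorem le_of_deriv_le (h : StableProfile n v dv P ε) {k r : ℝ} (hε : 0 < ε)
    (hk : 1 < k) (hr : 0 ≤ r) (hr2 : (k - 1) * r ^ 2 ≤ (n + 1) * ε)
    (hdv : ∀ s ∈ Icc 0 r, dv s * v s ^ (-k) ≤ ε ^ (-k) * (s / (n + 1))) :
    v r ≤ 2 ^ (1 / (k - 1)) * ε := by
  have hd : ∀ s, HasDerivAt
      (fun s => v s ^ (1 - k) + (k - 1) * (ε ^ (-k) * (s ^ 2 / (2 * (n + 1)))))
      ((k - 1) * (ε ^ (-k) * (s / (n + 1)) - dv s * v s ^ (-k))) s := fun s => by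
    refine ((h.hasDerivAt_rpow (1 - k) s).add ((((hasDerivAt_pow 2 s).div_const
      (2 * (n + 1))).const_mul (ε ^ (-k))).const_mul (k - 1))).congr_deriv ?_
    simp only [Nat.cast_ofNat, Nat.add_one_sub_one, pow_one, sub_sub_cancel_left]
    field_simp
    ring
  have hmono : MonotoneOn
      (fun s => v s ^ (1 - k) + (k - 1) * (ε ^ (-k) * (s ^ 2 / (2 * (n + 1))))) (Icc 0 r) := by
    refine monotoneOn_of_deriv_nonneg (convex_Icc 0 r)
      (fun s _ => (hd s).continuousAt.continuousWithinAt)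
      (fun s _ => (hd s).differentiableAt.differentiableWithinAt) fun s hs => ?_
    rw [(hd s).deriv]
    exact mul_nonneg (by linarith) (sub_nonneg.2 (hdv s (interior_subset hs)))
  have h1 := hmono (left_mem_Icc.2 hr) (right_mem_Icc.2 hr) hr
  simp only [h.initial] at h1
  have h2 : (k - 1) * (ε ^ (-k) * (r ^ 2 / (2 * (n + 1)))) ≤ ε ^ (1 - k) / 2 := by
    have h3 : ε ^ (1 - k) = ε ^ (-k) * ε := by
      rw [← Real.rpow_add_one hε.ne']
      congr 1
      ring
    have h4 : 0 < ε ^ (-k) := Real.rpow_pos_of_pos hε _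
    calc (k - 1) * (ε ^ (-k) * (r ^ 2 / (2 * (n + 1))))
        = ε ^ (-k) / (2 * (n + 1)) * ((k - 1) * r ^ 2) := by ring
      _ ≤ ε ^ (-k) / (2 * (n + 1)) * ((n + 1) * ε) := by gcongr
      _ = _ := by
        rw [h3]
        field_simp
  have h3 : (2 ^ (1 / (k - 1)) * ε) ^ (1 - k) = ε ^ (1 - k) / 2 := by
    rw [Real.mul_rpow (by positivity) hε.le, ← Real.rpow_mul zero_le_two,
      show 1 / (k - 1) * (1 - k) = -1 by
        have : k - 1 ≠ 0 := by linarith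
        field_simp
        ring, Real.rpow_neg_one]
    ring
  have h4 : (2 ^ (1 / (k - 1)) * ε) ^ (1 - k) ≤ v r ^ (1 - k) := by
    rw [h3]
    simp only [ne_eq, OfNat.ofNat_ne_zero, not_false_eq_true, zero_pow, zero_div, mul_zero,
      add_zero] at h1
    linarith
  exact (Real.rpow_le_rpow_iff_of_neg (by positivity) (h.pos r) (by linarith)).1 h4

/-- The incompatibility estimate: if `P * v` stays in `[l, k]` while `v` grows from `ε` to `K * ε`,
then `K` is bounded in terms of `n, l, k, m, b` only. -/
theorem growth_bound (h : StableProfile n v dv P ε) {k l m b K ρ : ℝ} (hε : 0 < ε) (hk : 1 < k)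
    (hl0 : 0 ≤ l) (hm : k < 2 * m + 1) (hb1 : (n + 1 : ℝ) < 2 * b) (hb2 : m + 1 ≤ b)
    (hlm : m ^ 2 < l * (2 * m + 1 - k))
    (hρ : 0 ≤ ρ) (hvρ : v ρ = K * ε) (hK : 2 ^ (1 / (k - 1)) < K)
    (hl : ∀ r ∈ Icc 0 ρ, l ≤ P r * v r) (hPk : ∀ r ∈ Icc 0 ρ, P r * v r ≤ k)
    (hdv : ∀ s ∈ Icc 0 ρ, dv s * v s ^ (-k) ≤ ε ^ (-k) * (s / (n + 1))) :
    (l - m ^ 2 / (2 * m + 1 - k)) * ((2 ^ (1 / (k - 1))) ^ (-2 * m - 1) *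
        (Real.sqrt ((n + 1) / (k - 1)) ^ (n + 1) / (n + 1))) ≤
      2 * l * ((4 * (n + 1)) ^ b / (2 * b - (n + 1))) * K ^ (b - 2 * m - 1) := by
  set e := Real.sqrt ε
  have he : 0 < e := Real.sqrt_pos.2 hε
  have hεe : ε = e ^ 2 := (Real.sq_sqrt hε.le).symm
  set c₁ : ℝ := 2 ^ (1 / (k - 1))
  have hc₁ : 0 < c₁ := by positivity
  have hK0 : 0 < K := hc₁.trans hK
  set η := Real.sqrt ((n + 1) / (k - 1))
  have hk1 : 0 < k - 1 := by linarith
  have hη : η ^ 2 = (n + 1) / (k - 1) := Real.sq_sqrt (by positivity)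
  have hη0 : 0 ≤ η := Real.sqrt_nonneg _
  have hupper : ∀ r, 0 ≤ r → r ≤ η * e → r ≤ ρ → v r ≤ c₁ * ε := fun r h0 h1 h2 => by
    refine h.le_of_deriv_le hε hk h0 ?_ fun s hs => hdv s ⟨hs.1, hs.2.trans h2⟩
    calc (k - 1) * r ^ 2 ≤ (k - 1) * (η * e) ^ 2 := by gcongr
      _ = (n + 1) * ε := by
        rw [mul_pow, hη, hεe]
        field_simp
  -- K exceeds the growth factor c₁, so v cannot reach Kε before radius η √ε.
  have hrρ : η * e ≤ ρ := by
    by_contra hlt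
    have h1 := hupper ρ hρ (not_le.1 hlt).le le_rfl
    rw [hvρ] at h1
    exact (mul_lt_mul_of_pos_right hK hε).not_ge h1
  set B := ∫ r in (0 : ℝ)..ρ, r ^ n * v r ^ (-2 * m - 1)
  set D := ∫ r in (0 : ℝ)..ρ, r ^ n * v r ^ (-m - 1)
  set I := ∫ r in (0 : ℝ)..ρ, r ^ n * (v r ^ (-2 * m - 2) * dv r ^ 2)
  set C := (4 * ((n : ℝ) + 1)) ^ b / (2 * b - (n + 1))
  have hint : ∀ p a c : ℝ, IntervalIntegrable (fun r => r ^ n * v r ^ p) volume a c := fun p a c => by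
    have := h.continuous_rpow p
    exact Continuous.intervalIntegrable (by fun_prop) _ _
  -- The main integral is bounded below by its part over [0, η √ε], where v ≤ c₁ ε.
  have hB : (c₁ * ε) ^ (-2 * m - 1) * ((η * e) ^ (n + 1) / (n + 1)) ≤ B := by
    have h1 : ∫ r in (0 : ℝ)..(η * e), r ^ n * v r ^ (-2 * m - 1) ≤ B :=
      intervalIntegral.integral_mono_interval le_rfl (by positivity) hrρ (by
        filter_upwards [ae_restrict_mem measurableSet_Ioc] with r hr
        exact mul_nonneg (pow_nonneg hr.1.le n) (Real.rpow_nonneg (h.pos r).le _)) (hint _ _ _)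
    refine le_trans ?_ h1
    have h2 : ∫ r in (0 : ℝ)..(η * e), (c₁ * ε) ^ (-2 * m - 1) * r ^ n =
        (c₁ * ε) ^ (-2 * m - 1) * ((η * e) ^ (n + 1) / (n + 1)) := by
      rw [intervalIntegral.integral_const_mul, integral_pow]
      simp
    rw [← h2]
    refine intervalIntegral.integral_mono_on (by positivity)
      (Continuous.intervalIntegrable (by fun_prop) _ _) (hint _ _ _) fun r hr => ?_
    rw [mul_comm]
    refine mul_le_mul_of_nonneg_left ?_ (pow_nonneg hr.1 n)
    exact Real.rpow_le_rpow_of_nonpos (h.pos r) (hupper r hr.1 hr.2 (hr.2.trans hrρ))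
      (by linarith)
  -- The integral of r^n v^(-m-1) need not converge at infinity; the factor v^(b-m-1) ≤ (Kε)^(b-m-1)
  -- is traded for the convergent exponent b.
  have hD : D ≤ (K * ε) ^ (b - m - 1) * (C * e ^ ((n + 1 : ℝ) - 2 * b)) := by
    have h1 := h.integral_rpow_neg_le he hεe hρ hb1
    have h2 : D ≤ (K * ε) ^ (b - m - 1) * ∫ r in (0 : ℝ)..ρ, r ^ n * v r ^ (-b) := by
      rw [← intervalIntegral.integral_const_mul]
      refine intervalIntegral.integral_mono_on hρ (hint _ _ _) ((hint _ _ _).const_mul _)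
        fun r hr => ?_
      have h3 : v r ≤ K * ε := by
        rw [← hvρ]
        exact h.monotoneOn (mem_Ici.2 hr.1) (mem_Ici.2 hρ) hr.2
      have h4 : v r ^ (-m - 1) = v r ^ (b - m - 1) * v r ^ (-b) := by
        rw [← Real.rpow_add (h.pos r)]
        congr 1
        ring
      have h5 : v r ^ (b - m - 1) ≤ (K * ε) ^ (b - m - 1) :=
        Real.rpow_le_rpow (h.pos r).le h3 (by linarith)
      rw [h4, mul_left_comm]
      exact mul_le_mul_of_nonneg_right h5
        (mul_nonneg (pow_nonneg hr.1 n) (Real.rpow_nonneg (h.pos r).le _))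
    exact h2.trans (mul_le_mul_of_nonneg_left h1 (by positivity))
  have hI := h.integral_energy_le (m := m) hρ hPk
  have hS := h.integral_potential_le (m := m) hρ hvρ hl0 hl
  have h2m : 0 < 2 * m + 1 - k := by linarith
  have hκ : 0 < l - m ^ 2 / (2 * m + 1 - k) := by
    rw [sub_pos, div_lt_iff₀ h2m]
    exact hlm
  have hI2 : m ^ 2 * I ≤ m ^ 2 / (2 * m + 1 - k) * B := by
    rw [div_mul_eq_mul_div, mul_div_assoc]
    refine mul_le_mul_of_nonneg_left ?_ (sq_nonneg m)
    rw [le_div_iff₀ h2m, mul_comm]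
    exact hI
  have hmain : (l - m ^ 2 / (2 * m + 1 - k)) * B ≤ 2 * l * ((K * ε) ^ (-m) * D) := by
    linarith
  have hscale : 0 < e ^ ((n + 1 : ℝ) - 2 * (2 * m + 1)) := Real.rpow_pos_of_pos he _
  have hpow : ∀ p : ℝ, ε ^ p = e ^ (2 * p) := fun p => by
    rw [hεe, ← Real.rpow_natCast_mul he.le]
    norm_num
  -- Both sides carry the same power of e = √ε, so cancelling it leaves a bound free of ε.
  refine le_of_mul_le_mul_right ?_ hscale
  calc (l - m ^ 2 / (2 * m + 1 - k)) * (c₁ ^ (-2 * m - 1) * (η ^ (n + 1) / (n + 1))) *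
        e ^ ((n + 1 : ℝ) - 2 * (2 * m + 1))
      = (l - m ^ 2 / (2 * m + 1 - k)) *
        ((c₁ * ε) ^ (-2 * m - 1) * ((η * e) ^ (n + 1) / (n + 1))) := by
        rw [Real.mul_rpow hc₁.le hε.le, hpow, mul_pow, ← Real.rpow_natCast e (n + 1),
          show (n + 1 : ℝ) - 2 * (2 * m + 1) = 2 * (-2 * m - 1) + ((n + 1 : ℕ) : ℝ) by
            push_cast
            ring, Real.rpow_add he]
        ring
    _ ≤ (l - m ^ 2 / (2 * m + 1 - k)) * B := by gcongr
    _ ≤ 2 * l * ((K * ε) ^ (-m) * D) := hmain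
    _ ≤ 2 * l * ((K * ε) ^ (-m) *
        ((K * ε) ^ (b - m - 1) * (C * e ^ ((n + 1 : ℝ) - 2 * b)))) := by gcongr
    _ = 2 * l * C * ((K * ε) ^ (b - 2 * m - 1) * e ^ ((n + 1 : ℝ) - 2 * b)) := by
        rw [show b - 2 * m - 1 = -m + (b - m - 1) by ring, Real.rpow_add (by positivity)]
        ring
    _ = 2 * l * C * K ^ (b - 2 * m - 1) * e ^ ((n + 1 : ℝ) - 2 * (2 * m + 1)) := by
        rw [Real.mul_rpow hK0.le hε.le, hpow, mul_assoc (K ^ _), ← Real.rpow_add he,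
          show 2 * (b - 2 * m - 1) + ((n + 1 : ℝ) - 2 * b) = (n + 1 : ℝ) - 2 * (2 * m + 1) by ring]
        ring

end StableProfile

/-! ### Monotonicity and slope bounds for positive solutions. -/

namespace RegularSolution

variable {n : ℕ} {f u du : ℝ → ℝ} {α : ℝ}

theorem deriv_nonpos (h : RegularSolution n f α u du) (hf : IsNonlinearity f)
    (hpos : ∀ r, 0 < u r) {r : ℝ} (hr : 0 ≤ r) : du r ≤ 0 := by
  rcases hr.eq_or_lt with rfl | hr
  · exact h.deriv_zero.le
  have h1 : 0 ≤ ∫ t in (0 : ℝ)..r, t ^ n * f (u t) :=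
    intervalIntegral.integral_nonneg hr.le fun t ht =>
      mul_nonneg (pow_nonneg ht.1 n) (hf.pos _ (hpos t)).le
  have h2 := h.flux r
  have h3 := pow_pos hr n
  by_contra hlt
  have := mul_pos h3 (not_le.1 hlt)
  linarith

theorem antitoneOn (h : RegularSolution n f α u du) (hf : IsNonlinearity f)
    (hpos : ∀ r, 0 < u r) : AntitoneOn u (Ici 0) :=
  antitoneOn_of_deriv_nonpos (convex_Ici 0) h.continuous.continuousOn
    (fun r _ => (h.hasDerivAt r).differentiableAt.differentiableWithinAt) fun r hr => by
      rw [(h.hasDerivAt r).deriv]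
      exact h.deriv_nonpos hf hpos (interior_subset hr)

theorem deriv_bounds (h : RegularSolution n f α u du) (hf : IsNonlinearity f)
    (hpos : ∀ r, 0 < u r) {r : ℝ} (hr : 0 ≤ r) :
    f (u r) * (r / (n + 1)) ≤ -du r ∧ -du r ≤ f α * (r / (n + 1)) := by
  rcases hr.eq_or_lt with rfl | hr
  · simp [h.deriv_zero]
  have huc := h.continuous
  have hfc := hf.continuous
  have hrn := pow_pos hr n
  have hpow : ∀ c : ℝ, ∫ t in (0 : ℝ)..r, t ^ n * c = r ^ n * (c * (r / (n + 1))) := fun c => by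
    rw [intervalIntegral.integral_mul_const, integral_pow]
    simp only [ne_eq, Nat.add_eq_zero_iff, one_ne_zero, and_false, not_false_eq_true, zero_pow,
      sub_zero]
    ring
  have hflux : r ^ n * -du r = ∫ t in (0 : ℝ)..r, t ^ n * f (u t) := by
    rw [mul_neg, h.flux, neg_neg]
  constructor
  · refine le_of_mul_le_mul_left ?_ hrn
    rw [hflux, ← hpow]
    refine intervalIntegral.integral_mono_on hr.le
      (Continuous.intervalIntegrable (by fun_prop) _ _)
      (Continuous.intervalIntegrable (by fun_prop) _ _) fun t ht =>
      mul_le_mul_of_nonneg_left ?_ (pow_nonneg ht.1 n)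
    exact (hf.strictMonoOn.le_iff_le (hpos r).le (hpos t).le).2
      (h.antitoneOn hf hpos ht.1 hr.le ht.2)
  · refine le_of_mul_le_mul_left ?_ hrn
    rw [hflux, ← hpow]
    refine intervalIntegral.integral_mono_on hr.le
      (Continuous.intervalIntegrable (by fun_prop) _ _)
      (Continuous.intervalIntegrable (by fun_prop) _ _) fun t ht =>
      mul_le_mul_of_nonneg_left ?_ (pow_nonneg ht.1 n)
    have h1 := h.antitoneOn hf hpos (mem_Ici.2 le_rfl) ht.1 ht.1
    rw [h.initial] at h1
    exact (hf.strictMonoOn.le_iff_le (hpos t).le ((hpos t).le.trans h1)).2 h1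

end RegularSolution

/-! ### Instability for large initial values -/

theorem RegularSolution.stableProfile {n : ℕ} {f u du : ℝ → ℝ} {α : ℝ} (hf : IsNonlinearity f)
    (h : RegularSolution n f α u du) (hpos : ∀ r, 0 < u r)
    (hs : IsRadiallyStable (n + 1) f u) :
    StableProfile n (fun r => tailIntegral f (u r)) (fun r => -du r / f (u r))
      (fun r => deriv f (u r)) (tailIntegral f α) := by
  have huc := h.continuous
  have hfu : ∀ r, 0 < f (u r) := fun r => hf.pos _ (hpos r)
  have hd : ∀ r, HasDerivAt (fun r => tailIntegral f (u r)) (-du r / f (u r)) r := fun r =>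
    ((hf.hasDerivAt_tail (hpos r)).comp r (h.hasDerivAt r)).congr_deriv (by ring)
  have hVc : Continuous fun r => deriv f (u r) := hf.continuous_deriv.comp huc
  refine ⟨by rw [h.initial], hd, h.continuous_deriv.neg.div (hf.continuous.comp huc)
    fun r => (hfu r).ne', by simp [h.deriv_zero], fun r => hf.tail_pos (hpos r), hVc, fun r => ?_,
    fun r hr => div_nonneg (neg_nonneg.2 (h.deriv_nonpos hf hpos hr)) (hfu r).le, ?_,
    fun g g' R hR hg hc h0 hgR => hs.integral_nonneg hVc hR hg hc h0 hgR⟩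
  · have h1 := ((h.hasDerivAt_flux hf.continuous r).neg).div
      ((hf.hasDerivAt (u r)).comp r (h.hasDerivAt r)) (hfu r).ne'
    refine (h1.congr_deriv ?_).congr_of_eventuallyEq (Eventually.of_forall fun s => ?_)
    · have := (hfu r).ne'
      simp only [Function.comp_apply, Pi.neg_apply]
      field_simp
      ring
    · simp only [Pi.div_apply, Pi.neg_apply, Function.comp_apply]
      ring
  · have hmono : MonotoneOn (fun r => tailIntegral f (u r) - r ^ 2 / (2 * (n + 1))) (Ici 0) := by
      have hd2 : ∀ r, HasDerivAt (fun r => tailIntegral f (u r) - r ^ 2 / (2 * (n + 1)))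
          (-du r / f (u r) - r / (n + 1)) r := fun r => by
        refine ((hd r).sub ((hasDerivAt_pow 2 r).div_const (2 * (n + 1)))).congr_deriv ?_
        simp only [Nat.cast_ofNat, Nat.add_one_sub_one, pow_one]
        rw [mul_div_mul_left _ _ two_ne_zero]
      refine monotoneOn_of_deriv_nonneg (convex_Ici 0)
        (fun r _ => (hd2 r).continuousAt.continuousWithinAt)
        (fun r _ => (hd2 r).differentiableAt.differentiableWithinAt) fun r hr => ?_
      rw [(hd2 r).deriv, sub_nonneg, le_div_iff₀ (hfu r), mul_comm]
      exact (h.deriv_bounds hf hpos (interior_subset hr)).1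
    intro r hr
    have h1 := hmono (mem_Ici.2 le_rfl) hr hr
    simp only [h.initial, ne_eq, OfNat.ofNat_ne_zero, not_false_eq_true, zero_pow, zero_div,
      sub_zero] at h1
    linarith

/-- The derivative of f F^k is F^(k-1) (f'F - k) ≤ 0. With -u' ≤ f(α) r/(n + 1) this yields the
bound on v' v^(-k) required by `growth_bound`. -/
theorem IsNonlinearity.mul_tail_rpow_le {f : ℝ → ℝ} (hf : IsNonlinearity f) {u₀ k : ℝ}
    (hu₀ : 0 < u₀) (hk : ∀ y, u₀ ≤ y → deriv f y * tailIntegral f y ≤ k) {x y : ℝ} (hx : u₀ ≤ x)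
    (hxy : x ≤ y) : f y * tailIntegral f y ^ k ≤ f x * tailIntegral f x ^ k := by
  have hd : ∀ z, u₀ ≤ z → HasDerivAt (fun z => f z * tailIntegral f z ^ k)
      (tailIntegral f z ^ (k - 1) * (deriv f z * tailIntegral f z - k)) z := fun z hz => by
    have hz0 := hu₀.trans_le hz
    have hF := hf.tail_pos hz0
    have := (hf.pos z hz0).ne'
    refine ((hf.hasDerivAt z).mul ((hf.hasDerivAt_tail hz0).rpow_const (p := k)
      (Or.inl hF.ne'))).congr_deriv ?_
    have h1 : tailIntegral f z ^ k = tailIntegral f z ^ (k - 1) * tailIntegral f z := by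
      rw [← Real.rpow_add_one hF.ne', sub_add_cancel]
    rw [h1]
    field_simp
    ring
  have hanti : AntitoneOn (fun z => f z * tailIntegral f z ^ k) (Ici u₀) := by
    refine antitoneOn_of_deriv_nonpos (convex_Ici u₀)
      (fun z hz => (hd z hz).continuousAt.continuousWithinAt)
      (fun z hz => (hd z (interior_subset hz)).differentiableAt.differentiableWithinAt)
      fun z hz => ?_
    have hz := interior_subset hz
    rw [(hd z hz).deriv]
    exact mul_nonpos_of_nonneg_of_nonpos
      (Real.rpow_nonneg (hf.tail_pos (hu₀.trans_le hz)).le _) (sub_nonpos.2 (hk z hz))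
  exact hanti hx (hx.trans hxy) hxy

theorem RegularSolution.growth_bound_of_stable {n : ℕ} {f u du : ℝ → ℝ} {α : ℝ}
    (hf : IsNonlinearity f) (h : RegularSolution n f α u du) (hα : 0 < α)
    (hpos : ∀ r, 0 < u r) (hs : IsRadiallyStable (n + 1) f u) {u₀ k l m b K : ℝ} (hu₀ : 0 < u₀)
    (hlk : ∀ y, u₀ ≤ y →
      l ≤ deriv f y * tailIntegral f y ∧ deriv f y * tailIntegral f y ≤ k) (hk : 1 < k)
    (hl0 : 0 ≤ l) (hm : k < 2 * m + 1) (hb1 : (n + 1 : ℝ) < 2 * b) (hb2 : m + 1 ≤ b)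
    (hlm : m ^ 2 < l * (2 * m + 1 - k)) (hK1 : 1 < K) (hK : 2 ^ (1 / (k - 1)) < K)
    (hαK : K * tailIntegral f α < tailIntegral f u₀) :
    (l - m ^ 2 / (2 * m + 1 - k)) * ((2 ^ (1 / (k - 1))) ^ (-2 * m - 1) *
        (Real.sqrt ((n + 1) / (k - 1)) ^ (n + 1) / (n + 1))) ≤
      2 * l * ((4 * (n + 1)) ^ b / (2 * b - (n + 1))) * K ^ (b - 2 * m - 1) := by
  have hv := h.stableProfile hf hpos hs
  set ε := tailIntegral f α
  have hε : 0 < ε := hf.tail_pos hα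
  obtain ⟨ρ, hρ, hvρ⟩ : ∃ ρ, 0 ≤ ρ ∧ tailIntegral f (u ρ) = K * ε := by
    -- At this radius the lower bound ε + r²/(2(n + 1)) already exceeds Kε, so v takes the value Kε
    -- before it.
    set r₁ := Real.sqrt (2 * (n + 1) * (K * ε))
    have hr₁ : 0 ≤ r₁ := Real.sqrt_nonneg _
    have h1 : K * ε ≤ tailIntegral f (u r₁) := by
      refine le_trans ?_ (hv.lower r₁ hr₁)
      rw [Real.sq_sqrt (by positivity), mul_div_cancel_left₀ _ (by positivity)]
      linarith
    have h2 : tailIntegral f (u 0) ≤ K * ε := by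
      rw [h.initial]
      nlinarith
    obtain ⟨ρ, hρ, hρ2⟩ := intermediate_value_Icc hr₁ hv.continuous.continuousOn ⟨h2, h1⟩
    exact ⟨ρ, hρ.1, hρ2⟩
  have hularge : ∀ r ∈ Icc 0 ρ, u₀ ≤ u r := fun r hr => by
    by_contra hlt
    have h1 := hf.tail_strictAnti (mem_Ioi.2 (hpos r)) (mem_Ioi.2 hu₀) (not_le.1 hlt)
    have h2 := hv.monotoneOn (mem_Ici.2 hr.1) (mem_Ici.2 hρ) hr.2
    simp only [hvρ] at h2
    linarith
  refine hv.growth_bound hε hk hl0 hm hb1 hb2 hlm hρ hvρ hK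
    (fun r hr => (hlk _ (hularge r hr)).1) (fun r hr => (hlk _ (hularge r hr)).2) fun r hr => ?_
  have hfu := hf.pos _ (hpos r)
  have hFu := hf.tail_pos (hpos r)
  have huα : u r ≤ α := by
    have := h.antitoneOn hf hpos (mem_Ici.2 le_rfl) (mem_Ici.2 hr.1) hr.1
    rwa [h.initial] at this
  have h1 := hf.mul_tail_rpow_le hu₀ (fun y hy => (hlk y hy).2) (hularge r hr) huα
  have h2 := (h.deriv_bounds hf hpos hr.1).2
  have hr0 : 0 ≤ r / (n + 1) := div_nonneg hr.1 (by positivity)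
  rw [Real.rpow_neg hFu.le, Real.rpow_neg hε.le, ← div_eq_mul_inv, div_div,
    div_le_iff₀ (mul_pos hfu (Real.rpow_pos_of_pos hFu k))]
  have hεk : 0 < ε ^ k := Real.rpow_pos_of_pos hε k
  calc -du r ≤ f α * (r / (n + 1)) := h2
    _ = (ε ^ k)⁻¹ * (r / (n + 1)) * (f α * ε ^ k) := by field_simp
    _ ≤ (ε ^ k)⁻¹ * (r / (n + 1)) * (f (u r) * tailIntegral f (u r) ^ k) := by gcongr

/-- Choice of the exponent `m` and of the tolerance `δ` in the supercritical range. -/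
theorem exists_exponents {n : ℕ} (hn : 10 ≤ n) {q : ℝ} (hq : qJL (n + 1) < q) :
    ∃ m δ : ℝ, 0 < δ ∧ 1 < q + δ ∧ 0 ≤ q - δ ∧ 0 < m ∧ q + δ < 2 * m + 1 ∧
      (n - 1 : ℝ) / 4 < m ∧ m ^ 2 < (q - δ) * (2 * m + 1 - (q + δ)) := by
  have hn' : (10 : ℝ) ≤ n := by exact_mod_cast hn
  set s := Real.sqrt n
  have hs : s ^ 2 = n := Real.sq_sqrt n.cast_nonneg
  have hs3 : 3 < s := Real.lt_sqrt_of_sq_lt (by norm_num; linarith)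
  have hqs : (s - 1) ^ 2 / 4 < q := by
    unfold qJL at hq
    push_cast at hq
    rw [add_sub_cancel_right] at hq
    change ((n : ℝ) + 1 - 2 * s) / 4 < q at hq
    nlinarith
  have hq1 : 1 < q := by nlinarith
  have hq0 : 0 < q := by linarith
  have hsq : (s - 1) / 2 < Real.sqrt q := Real.lt_sqrt_of_sq_lt (by linarith)
  have hsqpos : 0 < Real.sqrt q := Real.sqrt_pos.2 hq0
  -- With s = √n, the value (s - 1)²/4 for q would give q + √q = (n - 1)/4 exactly; hence the
  -- interval for m is nonempty precisely because q > q_JL.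
  obtain ⟨m, hm1, hm2⟩ : ∃ m, max ((n - 1 : ℝ) / 4) (q - Real.sqrt q) < m ∧
      m < q + Real.sqrt q :=
    exists_between (max_lt (by nlinarith) (by linarith))
  obtain ⟨hm3, hm4⟩ := max_lt_iff.1 hm1
  have hmq : m ^ 2 < q * (2 * m + 1 - q) := by
    have h1 : (m - q) ^ 2 < Real.sqrt q ^ 2 := sq_lt_sq' (by linarith) (by linarith)
    rw [Real.sq_sqrt hq0.le] at h1
    linarith
  have hm5 : 0 < 2 * m + 1 - q :=
    pos_of_mul_pos_right ((sq_nonneg m).trans_lt hmq) hq0.le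
  -- The strict inequality at δ = 0 survives a small tolerance.
  have e1 : ∀ᶠ δ in 𝓝 (0 : ℝ), m ^ 2 < (q - δ) * (2 * m + 1 - (q + δ)) := by
    have hc : Continuous fun δ : ℝ => (q - δ) * (2 * m + 1 - (q + δ)) := by fun_prop
    exact (hc.tendsto 0).eventually (lt_mem_nhds (by simpa using hmq))
  obtain ⟨δ, ⟨hδ1, hδ2, hδ3⟩, hδ0⟩ := (((e1.and ((gt_mem_nhds hm5).and
    (gt_mem_nhds hq0))).filter_mono (nhdsWithin_le_nhds (s := Ioi 0))).and
    self_mem_nhdsWithin).exists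
  have hδ0 : 0 < δ := hδ0
  exact ⟨m, δ, hδ0, by linarith, by linarith, by linarith, by linarith, hm3, hδ1⟩

theorem exists_forall_not_isRadiallyStable {n : ℕ} (hn : 10 ≤ n) {f : ℝ → ℝ}
    (hf : IsNonlinearity f) {q : ℝ}
    (hlim : Tendsto (fun u => deriv f u * tailIntegral f u) atTop (𝓝 q)) (hq : qJL (n + 1) < q)
    {u du : ℝ → ℝ → ℝ} (hu : ∀ α, 0 < α → RegularSolution n f α (u α) (du α)) :
    ∃ αhat, 0 < αhat ∧ ∀ α, αhat < α → ¬ IsRadiallyStable (n + 1) f (u α) := by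
  obtain ⟨m, δ, hδ, hk, hl, hm0, hmk, hmn, hlm⟩ := exists_exponents hn hq
  -- Room for b comes from m > 0 and m > (n - 1)/4; b < 2m + 1 makes the power of K decay.
  obtain ⟨b, hb1, hb2⟩ : ∃ b, max (m + 1) ((n + 1 : ℝ) / 2) < b ∧ b < 2 * m + 1 :=
    exists_between (max_lt (by linarith) (by linarith))
  obtain ⟨hb3, hb4⟩ := max_lt_iff.1 hb1
  obtain ⟨u₀, hu₀⟩ := eventually_atTop.1
    ((hlim.eventually (Metric.ball_mem_nhds q hδ)).and (eventually_gt_atTop 0))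
  have hu₀pos : 0 < u₀ := (hu₀ u₀ le_rfl).2
  have hlk : ∀ y, u₀ ≤ y → q - δ ≤ deriv f y * tailIntegral f y ∧
      deriv f y * tailIntegral f y ≤ q + δ := fun y hy => by
    have h1 := (hu₀ y hy).1
    rw [Real.dist_eq, abs_lt] at h1
    constructor <;> linarith
  set c := ((q - δ) - m ^ 2 / (2 * m + 1 - (q + δ))) *
    ((2 ^ (1 / ((q + δ) - 1))) ^ (-2 * m - 1) *
      (Real.sqrt ((n + 1) / ((q + δ) - 1)) ^ (n + 1) / (n + 1)))
  set C := 2 * (q - δ) * ((4 * ((n : ℝ) + 1)) ^ b / (2 * b - (n + 1)))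
  have hc : 0 < c := by
    have h1 : 0 < (q - δ) - m ^ 2 / (2 * m + 1 - (q + δ)) := by
      rw [sub_pos, div_lt_iff₀ (by linarith)]
      exact hlm
    have h2 : 0 < q + δ - 1 := by linarith
    positivity
  have hCK : Tendsto (fun K : ℝ => C * K ^ (b - 2 * m - 1)) atTop (𝓝 0) := by
    have h1 := tendsto_rpow_neg_atTop (y := 2 * m + 1 - b) (by linarith)
    simp only [show -(2 * m + 1 - b) = b - 2 * m - 1 by ring] at h1
    simpa using h1.const_mul C
  -- K is fixed before α, since neither side of the growth bound depends on α.
  obtain ⟨K, hK1, hK2, hK3⟩ := ((hCK.eventually (gt_mem_nhds hc)).and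
    ((eventually_gt_atTop 1).and (eventually_gt_atTop (2 ^ (1 / ((q + δ) - 1)))))).exists
  have hαK : ∀ᶠ α in atTop, K * tailIntegral f α < tailIntegral f u₀ := by
    have h1 := hf.tendsto_tail.const_mul K
    rw [mul_zero] at h1
    exact h1.eventually (gt_mem_nhds (hf.tail_pos hu₀pos))
  obtain ⟨a, ha⟩ := eventually_atTop.1 hαK
  refine ⟨max a 1, lt_max_of_lt_right one_pos, fun α hα hs => ?_⟩
  obtain ⟨hα1, hα2⟩ := max_lt_iff.1 hα
  have hα0 : 0 < α := one_pos.trans hα2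
  -- Positivity comes from comparison with the solution starting at α/2.
  have hpos : ∀ r, 0 < u α r := fun r => by
    obtain ⟨h1, h2⟩ := (hu α hα0).pos_and_lt_of_stable hf (hu (α / 2) (half_pos hα0)) hs
      (half_pos hα0) (half_lt_self hα0) r
    exact h1.trans h2
  have := (hu α hα0).growth_bound_of_stable hf hα0 hpos hs hu₀pos hlk hk hl hmk (by linarith)
    hb3.le hlm hK2 hK3 (ha α hα1.le)
  exact this.not_gt hK1

end RadialStability

theorem theorem1p6 (N : ℕ) (hN : 11 ≤ N) (f : ℝ → ℝ)
    (hf : RadialStability.IsNonlinearity f) (qInf : ℝ)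
    (hlim : Filter.Tendsto (fun u : ℝ => deriv f u * RadialStability.tailIntegral f u)
      Filter.atTop (nhds qInf))
    (hq : RadialStability.qJL N < qInf) :
    ∃ u : ℝ → ℝ → ℝ,
      (∀ α : ℝ, 0 < α → RadialStability.IsRadialSolution N f α (u α) ∧
        ∀ w : ℝ → ℝ, RadialStability.IsRadialSolution N f α w →
          Set.EqOn w (u α) (Set.Ici 0)) ∧
      (∃ αhat : ℝ, 0 < αhat ∧
        ∀ α : ℝ, αhat < α → ¬ RadialStability.IsRadiallyStable N f (u α)) ∧
      (RadialStability.StructureI N f u ∨ RadialStability.StructureIII N f u) := by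
  obtain ⟨n, rfl⟩ : ∃ n, N = n + 1 := ⟨N - 1, by omega⟩
  have hex : ∀ α : ℝ, ∃ u du : ℝ → ℝ,
      0 < α → RadialStability.RegularSolution n f α u du ∧ ∀ r, |u r| ≤ α := fun α => by
    by_cases hα : 0 < α
    · obtain ⟨u, du, h⟩ := hf.exists_regularSolution n hα
      exact ⟨u, du, fun _ => h⟩
    · exact ⟨0, 0, fun h => absurd h hα⟩
  choose u du hu using hex
  have hunst := RadialStability.exists_forall_not_isRadiallyStable (by omega : 10 ≤ n) hf hlim hq
    fun α hα => (hu α hα).1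
  refine ⟨u, fun α hα => ⟨(hu α hα).1.isRadialSolution hf.continuous, fun w hw =>
    (hu α hα).1.eqOn_of_isRadialSolution (by omega) hf hw⟩, hunst, ?_⟩
  obtain ⟨αhat, _, hαhat⟩ := hunst
  exact RadialStability.structureI_or_structureIII hf (fun α hα => (hu α hα).1)
    (fun α hα => (hu α hα).2) hαhat
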